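/- **Setting.** Consider $N$ qubits and a parametrized circuit $\mathbf U(\boldsymbol\theta)=B_{m}\cdots B_2B_1$, $\boldsymbol\theta\in\mathbb R^M$ random, composed of blocks; the block $B_k$ acts on a set $s(B_k)$ of qubits, and blocks with smaller index act earlier. No assumption is made on the number, sizes or arrangement of the blocks. Fix a parameter $\theta_\mu$ that occurs in exactly one gate $U_\mu=e^{-i\theta_\mu\Omega_\mu}$, located inside one block, $B_{k(\mu)}=R\,U_\mu L$, where $\Omega_\mu$ is a non-identity Pauli string supported in $s(B_{k(\mu)})$. The blocks $B_k$ ($k\ne k(\mu)$) and the sub-blocks $L$ and $R$ are random unitaries forming unitary $2$-designs on $s(B_k)$, respectively on $s(B_{k(\mu)})$ for $L,R$; all of these, together with $\theta_\mu$, are mutually independent. Let $H=\sum_j\lambda_jh_j$ with $\lambda_j\in\mathbb R$ and distinct Pauli strings $h_j$ whose supports $s(h_j)$ are contained in $\bigcup_k s(B_k)$, and let $C(\boldsymbol\theta)=\langle \mathbf 0|\mathbf U^\dagger H\mathbf U|\mathbf 0\rangle$. **Causal cone.** Recursively from the last block to the first, $B_k$ is in the causal cone of $h_j$ if $s(B_k)$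 meets $s(h_j)$ or meets $s(B_{k'})$ for some $k'>k$ with $B_{k'}$ in the cone. **Path sets.** For $k<k'$ let $s_c(B_k,B_{k'})=\bigl(s(B_k)\cap s(B_{k'})\bigr)\setminus\bigcup_{k<i<k'}s(B_i)$; the two blocks are connected if this set is non-empty. Let $s_f(B_k)=s(B_k)\setminus\bigcup_{i<k}s(B_i)$ and $s_b(B_k)=s(B_k)\setminus\bigcup_{i>k}s(B_i)$. A path is a non-empty sequence $B_{k_1},\dots,B_{k_r}$ with $k_1<\dots<k_r$, consecutive blocks connected, $s_f(B_{k_1})\neq\varnothing$ and $s_b(B_{k_r})\ne\varnothing$; its head is $B_{k_1}$ and its edges are $(\rho_0,B_{k_1}),(B_{k_1},B_{k_2}),\dots,(B_{k_{r-1}},B_{k_r})$, where $\rho_0=|\mathbf 0\rangle\langle\mathbf 0|$. Edge lengths are $$l(B_k,B_{k'})=\log_4\frac{4^{|s(B_{k'})|}-1}{4^{|s_c(B_k,B_{k'})|}-1},\qquad l(\rho_0,B_k)=\log_4\frac{4^{|s(B_k)|}-1}{4^{|s_f(B_k)|}-1}.$$ A path set $P$ is a collection of paths. Its length $l(P)$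 is the sum of the lengths of all edges of its paths, each distinct edge counted once. Its head width $w(P)$ is the sum over the distinct head blocks $B_k$ of its paths of $w(B_k)=\log_2\frac{4^{|s_f(B_k)|}-1}{2^{|s_f(B_k)|}-1}$. We say that $P$ goes through $B_{k(\mu)}$ and covers $h_j$ if $s(h_j)$ is contained in the union of the $s_b(B)$ over all blocks $B$ of paths of $P$, and some path of $P$ contains $B_{k(\mu)}$ and connects it to $h_j$, i.e. $s_b(B)\cap s(h_j)\neq\varnothing$ for $B=B_{k(\mu)}$ or for some later block $B$ of that path. **Theorem.** For every $h_j$ whose causal cone contains $B_{k(\mu)}$ there exists a path set that goes through $B_{k(\mu)}$ and covers $h_j$. For any choice of such path sets $P_j$, $$\operatorname{Var}[\partial_\mu C]\;\ge\;\sum_j\lambda_j^2\cdot 2^{\,1-2l(P_j)-w(P_j)},$$ where $j$ runs over the indices of those $h_j$ whose causal cone contains $B_{k(\mu)}$. -/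

import Mathlib

/-!
In the Heisenberg picture the circuit acts on the vector of the expectations `⟨0|U†σU|0⟩`, indexed
by the Pauli strings `σ`, one block at a time. If a block is a `2`-design on `s`, then strings which
differ on `s` become uncorrelated, and the second moment at a string which is nontrivial on `s`
becomes the average of the earlier second moments over the `4 ^ |s| - 1` strings which agree with it
off `s` and are nontrivial on `s`. In the block `R U_μ L` the derivative of the rotation is
sandwiched between two such averages; it annihilates the strings commuting with `Ω` and scales the
others by `2`, and at least half of the strings anticommute with `Ω`, so that the average is
multiplied by at least `2`. Hence the `h_j` contribute separately to the variance, and all averages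
have nonnegative terms.

A path set for `h_j` selects a part of these terms: starting from `h_j`, keep only the strings which
are nontrivial on the qubits of an edge precisely if the path set contains this edge, and which on
the qubits taken over from the initial state only have the labels `I` and `Z`, whose expectations
there do not vanish. The edges into a block involve disjoint sets of qubits, so each edge
contributes the factor `(4 ^ |s_c| - 1) / (4 ^ |s| - 1)`, respectively
`(2 ^ |s_f| - 1) / (4 ^ |s| - 1)` for an edge from the initial state, which is where the head width
enters. Edges which do not lead to `h_j` are left out first; this only increases the bound, as the
factors are at most `1`.
-/

open MeasureTheory ProbabilityTheory

namespace PathBound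

/-! ### Pauli strings on `N` qubits -/

/-- The four single-qubit Pauli labels. -/
inductive Pauli where
  | I | X | Y | Z

/-- The Pauli matrices. -/
noncomputable def Pauli.toMatrix : Pauli → Matrix (Fin 2) (Fin 2) ℂ
  | .I => 1
  | .X => !![0, 1; 1, 0]
  | .Y => !![0, -Complex.I; Complex.I, 0]
  | .Z => !![1, 0; 0, -1]

/-- Computational basis labels of a family of qubits. -/
abbrev Bits (Q : Type) : Type := Q → Fin 2

/-- Linear operators on `N` qubits, written in the computational basis. -/
abbrev Op (N : ℕ) : Type := Matrix (Bits (Fin N)) (Bits (Fin N)) ℂ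

/-- A Pauli string `σ₁ ⊗ ⋯ ⊗ σ_N`. -/
abbrev PauliString (N : ℕ) : Type := Fin N → Pauli

/-- The operator `σ₁ ⊗ ⋯ ⊗ σ_N`. -/
noncomputable def PauliString.toOp {N : ℕ} (h : PauliString N) : Op N :=
  Matrix.of fun x y => ∏ q, (h q).toMatrix (x q) (y q)

open Classical in
/-- The support `s(h)`: the qubits on which the string is not the identity. -/
noncomputable def PauliString.supp {N : ℕ} (h : PauliString N) : Finset (Fin N) :=
  Finset.univ.filter fun q => h q ≠ Pauli.I

/-! ### The unitary group, Haar measure and unitary designs -/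

section Haar

variable {n : Type} [Fintype n] [DecidableEq n]

noncomputable instance : MeasurableSpace (Matrix.unitaryGroup n ℂ) := borel _

instance : BorelSpace (Matrix.unitaryGroup n ℂ) := ⟨rfl⟩

instance : CompactSpace (Matrix.unitaryGroup n ℂ) := by
  have hsub : ((Matrix.unitaryGroup n ℂ : Submonoid (Matrix n n ℂ)) : Set (Matrix n n ℂ)) ⊆
      Set.pi Set.univ fun _ : n => Set.pi Set.univ fun _ : n => Metric.closedBall (0 : ℂ) 1 := by
    intro U hU i _ j _
    simpa using entry_norm_bound_of_unitary hU i j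
  have hcomp : IsCompact
      (Set.pi Set.univ fun _ : n => Set.pi Set.univ fun _ : n => Metric.closedBall (0 : ℂ) 1) :=
    isCompact_univ_pi fun _ => isCompact_univ_pi fun _ => isCompact_closedBall _ _
  have hclosed : IsClosed
      ((Matrix.unitaryGroup n ℂ : Submonoid (Matrix n n ℂ)) : Set (Matrix n n ℂ)) := by
    have : ((Matrix.unitaryGroup n ℂ : Submonoid (Matrix n n ℂ)) : Set (Matrix n n ℂ)) =
        {U : Matrix n n ℂ | U * star U = 1} := by
      ext U
      exact Matrix.mem_unitaryGroup_iff
    rw [this]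
    exact isClosed_eq (continuous_id.mul continuous_star) continuous_const
  exact isCompact_iff_compactSpace.mp (hcomp.of_isClosed_subset hclosed hsub)

/-- The Haar probability measure on the unitary group (total mass one). -/
noncomputable def haarUnitary (n : Type) [Fintype n] [DecidableEq n] :
    Measure (Matrix.unitaryGroup n ℂ) :=
  Measure.haarMeasure (⊤ : TopologicalSpace.PositiveCompacts (Matrix.unitaryGroup n ℂ))

/-- A probability measure on the unitary group is a unitary `t`-design if all its moments of
degree `t` in the entries of `U` and degree `t` in the entries of `U†` are those of Haar measure.
These moments are the matrix entries of the `t`-fold twirling channel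
`X ↦ ∫ (U†)^{⊗t} X U^{⊗t}`. -/
def IsUnitaryDesign (t : ℕ) (ν : Measure (Matrix.unitaryGroup n ℂ)) : Prop :=
  IsProbabilityMeasure ν ∧
    ∀ i j k l : Fin t → n,
      ∫ U, (∏ a, (U : Matrix n n ℂ) (i a) (j a)) *
          (∏ a, star ((U : Matrix n n ℂ) (k a) (l a))) ∂ν =
        ∫ U, (∏ a, (U : Matrix n n ℂ) (i a) (j a)) *
          (∏ a, star ((U : Matrix n n ℂ) (k a) (l a))) ∂(haarUnitary n)

end Haar

/-- The unitaries acting on the qubits of `s`. -/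
abbrev LocalUnitary {N : ℕ} (s : Finset (Fin N)) : Type :=
  Matrix.unitaryGroup (Bits s) ℂ

open Classical in
/-- The operator `A ⊗ I` on all `N` qubits, for an operator `A` on the qubits of `s`. -/
noncomputable def embed {N : ℕ} (s : Finset (Fin N)) (A : Matrix (Bits s) (Bits s) ℂ) : Op N :=
  Matrix.of fun x y =>
    if ∀ q, q ∉ s → x q = y q then A (fun q => x q) (fun q => y q) else 0

/-! ### Geometry of a circuit: `m` blocks, the block `k` acting on the qubits `s k`,
blocks with a smaller index acting earlier -/

section Geometry

variable {N m : ℕ} (s : Fin m → Finset (Fin N))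

/-- The connecting support `s_c(B_k, B_k')` for `k < k'`. -/
def connSupp (k k' : Fin m) : Finset (Fin N) :=
  (s k ∩ s k') \ (Finset.univ.filter fun i => k < i ∧ i < k').biUnion s

/-- The forward residual support `s_f(B_k)`: the qubits of `B_k` on which no earlier block acts. -/
def fwdSupp (k : Fin m) : Finset (Fin N) :=
  s k \ (Finset.univ.filter fun i => i < k).biUnion s

/-- The backward residual support `s_b(B_k)`: the qubits of `B_k` on which no later block acts. -/
def bwdSupp (k : Fin m) : Finset (Fin N) :=
  s k \ (Finset.univ.filter fun i => k < i).biUnion s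

/-- The blocks in the causal cone of an observable with support `S`: a block is in the cone if it
acts on a qubit of `S`, or shares a qubit with a later block of the cone. -/
inductive InCausalCone (S : Finset (Fin N)) : Fin m → Prop
  | base (k : Fin m) : (s k ∩ S).Nonempty → InCausalCone S k
  | step (k k' : Fin m) : k < k' → (s k ∩ s k').Nonempty → InCausalCone S k' → InCausalCone S k

/-- A path: a nonempty time-ordered sequence of blocks in which adjacent blocks are connected,
and which traverses the whole circuit. -/
structure CircuitPath where
  /-- the blocks, the earliest first -/
  nodes : List (Fin m)
  ne_nil : nodes ≠ []
  chain : nodes.IsChain fun k k' => k < k' ∧ (connSupp s k k').Nonempty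
  head_fwd : (fwdSupp s (nodes.head ne_nil)).Nonempty
  tail_bwd : (bwdSupp s (nodes.getLast ne_nil)).Nonempty

variable {s}

/-- The first block of a path. -/
def CircuitPath.head (p : CircuitPath s) : Fin m := p.nodes.head p.ne_nil

/-- The edges of a path; an edge `(none, k)` joins the initial state `ρ₀` to the head `B_k`, an
edge `(some k, k')` joins the adjacent blocks `B_k`, `B_k'`. -/
def CircuitPath.edges (p : CircuitPath s) : Finset (Option (Fin m) × Fin m) :=
  insert (none, p.head) ((p.nodes.zip p.nodes.tail).map fun e => (some e.1, e.2)).toFinset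

/-- The backward residual support of a path. -/
def CircuitPath.bwd (p : CircuitPath s) : Finset (Fin N) :=
  p.nodes.toFinset.biUnion (bwdSupp s)

variable (s) in
/-- The length of an edge. -/
noncomputable def edgeLength : Option (Fin m) × Fin m → ℝ
  | (none, k) => Real.logb 4 (((4 : ℝ) ^ (s k).card - 1) / ((4 : ℝ) ^ (fwdSupp s k).card - 1))
  | (some k, k') =>
      Real.logb 4 (((4 : ℝ) ^ (s k').card - 1) / ((4 : ℝ) ^ (connSupp s k k').card - 1))

variable (s) in
/-- The forward width of a block. -/
noncomputable def fwdWidth (k : Fin m) : ℝ :=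
  Real.logb 2 (((4 : ℝ) ^ (fwdSupp s k).card - 1) / ((2 : ℝ) ^ (fwdSupp s k).card - 1))

variable (s) in
/-- A path set is a collection of paths. -/
abbrev PathSet : Type := Finset (CircuitPath s)

/-- The length of a path set: the total length of its edges, each edge counted once. -/
noncomputable def PathSet.length (P : PathSet s) : ℝ :=
  ∑ e ∈ P.biUnion CircuitPath.edges, edgeLength s e

/-- The head width of a path set: the total forward width of its head blocks, each head block
counted once. -/
noncomputable def PathSet.headWidth (P : PathSet s) : ℝ :=
  ∑ k ∈ P.image CircuitPath.head, fwdWidth s k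

/-- `P` goes through the block `k` and covers the observable support `S`: the backward residual
support of `P` contains `S`, and some path of `P` contains the block `k` and connects it to the
observable, i.e. `k`, or a later block of that path, acts last on a qubit of `S`. -/
def PathSet.GoesThroughAndCovers (P : PathSet s) (k : Fin m) (S : Finset (Fin N)) : Prop :=
  (∃ p ∈ P, k ∈ p.nodes ∧ ∃ k' ∈ p.nodes, k ≤ k' ∧ (bwdSupp s k' ∩ S).Nonempty) ∧
    S ⊆ P.biUnion CircuitPath.bwd

open Classical in
variable (s) in
/-- The indices of those Pauli strings whose causal cone contains the block `k`. -/
noncomputable def coneTerms {J : Type} [Fintype J] (h : J → PauliString N) (k : Fin m) :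
    Finset J :=
  Finset.univ.filter fun j => InCausalCone s (h j).supp k

end Geometry

/-! ### Parametrized circuits -/

/-- A parametrized circuit on `N` qubits with `M` real parameters, composed of `m` blocks: the
block `k` is a parameter-dependent unitary acting on the qubits of `s k`. -/
structure Circuit (N m M : ℕ) where
  s : Fin m → Finset (Fin N)
  block : (k : Fin m) → (Fin M → ℝ) → LocalUnitary (s k)

namespace Circuit

variable {N m M : ℕ} (c : Circuit N m M)

/-- The support of the circuit. -/
def supp : Finset (Fin N) := Finset.univ.biUnion c.s

/-- The circuit unitary, the block of index zero acting first (rightmost). -/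
noncomputable def unitary (θ : Fin M → ℝ) : Op N :=
  ((List.finRange m).reverse.map fun k => embed (c.s k) (c.block k θ).1).prod

/-- The cost `C(θ) = tr(ρ₀ U(θ)† H U(θ))`, where `ρ₀ = |0⟩⟨0|`; it is a real number for
Hermitian `H`. -/
noncomputable def cost (H : Op N) (θ : Fin M → ℝ) : ℝ :=
  (Matrix.trace (Matrix.single 0 0 1 * (c.unitary θ).conjTranspose * H * c.unitary θ)).re

/-- The partial derivative of the cost with respect to the parameter `μ`. -/
noncomputable def costDeriv (H : Op N) (μ : Fin M) (θ : Fin M → ℝ) : ℝ :=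
  deriv (fun t : ℝ => c.cost H (Function.update θ μ t)) (θ μ)

end Circuit

/-- The rotation gate `exp(-i t Ω)` generated by a Pauli string. -/
noncomputable def rotation {N : ℕ} (Ω : PauliString N) (t : ℝ) : Op N :=
  NormedSpace.exp ((-(Complex.I * (t : ℂ))) • Ω.toOp)

/-- A function of the parameters that does not depend on the parameter `μ`. -/
def IndepOfParam {M : ℕ} {α : Type} (μ : Fin M) (f : (Fin M → ℝ) → α) : Prop :=
  ∀ θ t, f (Function.update θ μ t) = f θ

/-- The circuit `c`, with random parameters of law `π`, is composed of blocks forming independent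
local `2`-designs, and its block `kμ` is `R · exp(-i θ_μ Ω) · L` where the gate with the parameter
`θ_μ` is sandwiched by two independent `2`-designs `L` (acting before it) and `R` (acting after it)
on the support of the block; `Ω` is a non-identity Pauli string supported there, and the parameter
`θ_μ` occurs in no other gate and is independent of the random unitaries. -/
structure IsDesignCircuit {N m M : ℕ} (c : Circuit N m M) (π : Measure (Fin M → ℝ))
    (μ : Fin M) (kμ : Fin m) (Ω : PauliString N)
    (L R : (Fin M → ℝ) → LocalUnitary (c.s kμ)) : Prop where
  generator_nontrivial : Ω.supp.Nonempty
  generator_supp : Ω.supp ⊆ c.s kμ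
  block_eq : ∀ θ, embed (c.s kμ) (c.block kμ θ).1 =
    embed (c.s kμ) (R θ).1 * rotation Ω (θ μ) * embed (c.s kμ) (L θ).1
  block_param : ∀ k, k ≠ kμ → IndepOfParam μ (c.block k)
  left_param : IndepOfParam μ L
  right_param : IndepOfParam μ R
  block_measurable : ∀ k, k ≠ kμ → Measurable (c.block k)
  left_measurable : Measurable L
  right_measurable : Measurable R
  block_design : ∀ k, k ≠ kμ → IsUnitaryDesign 2 (π.map (c.block k))
  left_design : IsUnitaryDesign 2 (π.map L)
  right_design : IsUnitaryDesign 2 (π.map R)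
  /-- The blocks other than `kμ`, the two sub-blocks `L`, `R` and the parameter `θ_μ` are mutually
  independent. -/
  indep : iIndep (Sum.elim
    (fun k : {k : Fin m // k ≠ kμ} => MeasurableSpace.comap (c.block k) inferInstance)
    ![MeasurableSpace.comap L inferInstance, MeasurableSpace.comap R inferInstance,
      MeasurableSpace.comap (fun θ : Fin M → ℝ => θ μ) inferInstance]) π

end PathBound

namespace PathBound

/-! ### Tensor products of matrices -/

section PiKronecker

variable {ι n R : Type*} [Fintype ι] [CommSemiring R]

/-- The tensor product `⨂ᵢ A i` of a finite family of matrices of the same size. -/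
def piKronecker (A : ι → Matrix n n R) : Matrix (ι → n) (ι → n) R :=
  Matrix.of fun x y => ∏ i, A i (x i) (y i)

theorem piKronecker_apply (A : ι → Matrix n n R) (x y : ι → n) :
    piKronecker A x y = ∏ i, A i (x i) (y i) := rfl

theorem piKronecker_smul (a : ι → R) (A : ι → Matrix n n R) :
    piKronecker (fun i => a i • A i) = (∏ i, a i) • piKronecker A := by
  ext x y
  simp only [piKronecker_apply, Matrix.smul_apply, smul_eq_mul, Finset.prod_mul_distrib]

theorem conjTranspose_piKronecker [StarRing R] (A : ι → Matrix n n R) :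
    (piKronecker A).conjTranspose = piKronecker fun i => (A i).conjTranspose := by
  ext x y
  simp only [piKronecker_apply, Matrix.conjTranspose_apply, star_prod]

theorem piKronecker_one [DecidableEq n] :
    piKronecker (fun _ : ι => (1 : Matrix n n R)) = 1 := by
  ext x y
  rcases eq_or_ne x y with rfl | hxy
  · simp [piKronecker_apply]
  · obtain ⟨i, hi⟩ := Function.ne_iff.1 hxy
    rw [Matrix.one_apply_ne hxy, piKronecker_apply]
    exact Finset.prod_eq_zero (Finset.mem_univ i) (Matrix.one_apply_ne hi)

variable [DecidableEq ι] [Fintype n]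

theorem piKronecker_mul (A B : ι → Matrix n n R) :
    piKronecker A * piKronecker B = piKronecker fun i => A i * B i := by
  ext x y
  simp only [Matrix.mul_apply, piKronecker_apply, ← Finset.prod_mul_distrib, Fintype.prod_sum]

theorem trace_piKronecker (A : ι → Matrix n n R) :
    (piKronecker A).trace = ∏ i, (A i).trace := by
  simp only [Matrix.trace, Matrix.diag, piKronecker_apply, Fintype.prod_sum]

end PiKronecker

/-! ### Pauli strings -/

namespace Pauli

instance : DecidableEq Pauli := fun a b => by
  cases a <;> cases b <;> first | exact isTrue rfl | exact isFalse nofun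

instance : Fintype Pauli where
  elems := {.I, .X, .Y, .Z}
  complete a := by cases a <;> decide

theorem card_eq_four : Fintype.card Pauli = 4 := rfl

/-- The commutation sign of two Pauli matrices: `1` if they commute, `-1` if they anticommute. -/
def commSign (a b : Pauli) : ℤ :=
  if a = .I ∨ b = .I ∨ a = b then 1 else -1

theorem commSign_self (a : Pauli) : commSign a a = 1 := by cases a <;> rfl

theorem commSign_I_left (a : Pauli) : commSign .I a = 1 := by cases a <;> rfl

theorem commSign_I_right (a : Pauli) : commSign a .I = 1 := by cases a <;> rfl

theorem commSign_eq_one_or_neg_one (a b : Pauli) : commSign a b = 1 ∨ commSign a b = -1 := by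
  revert a b; decide

theorem sum_commSign {a : Pauli} (ha : a ≠ .I) : ∑ p, commSign p a = 0 := by
  revert a; decide

theorem sum_commSign_mul_commSign_nonneg (a b : Pauli) :
    0 ≤ ∑ p, commSign p a * commSign p b := by
  revert a b; decide

theorem exists_commSign_mul_eq_neg_one {a b : Pauli} (h : a ≠ b) :
    ∃ p, commSign p a * commSign p b = -1 := by
  revert a b; decide

theorem toMatrix_mul_self (a : Pauli) : a.toMatrix * a.toMatrix = 1 := by
  cases a <;> simp [toMatrix, Matrix.one_fin_two]

theorem toMatrix_mul_comm (a b : Pauli) :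
    a.toMatrix * b.toMatrix = (commSign a b : ℂ) • (b.toMatrix * a.toMatrix) := by
  cases a <;> cases b <;> simp [toMatrix, commSign, Matrix.one_fin_two]

theorem conjTranspose_toMatrix (a : Pauli) : a.toMatrix.conjTranspose = a.toMatrix := by
  cases a <;> ext i j <;> fin_cases i <;> fin_cases j <;> simp [toMatrix]

theorem trace_toMatrix_mul (a b : Pauli) :
    (a.toMatrix * b.toMatrix).trace = if a = b then 2 else 0 := by
  cases a <;> cases b <;> simp [toMatrix, Matrix.trace_fin_two] <;> norm_num

theorem sum_toMatrix_mul_toMatrix (i j k l : Fin 2) :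
    ∑ a : Pauli, a.toMatrix i j * a.toMatrix k l = if i = l ∧ j = k then 2 else 0 := by
  have huniv : (Finset.univ : Finset Pauli) = {.I, .X, .Y, .Z} := rfl
  rw [huniv]
  fin_cases i <;> fin_cases j <;> fin_cases k <;> fin_cases l <;>
    simp [toMatrix] <;> norm_num

end Pauli

namespace PauliString

variable {N : ℕ}

/-- The commutation sign of two Pauli strings: `1` if they commute, `-1` if they anticommute. -/
def commSign (σ τ : PauliString N) : ℤ := ∏ q, (σ q).commSign (τ q)

/-- The string which agrees with `σ` on `s` and is trivial elsewhere. -/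
def restrict (s : Finset (Fin N)) (σ : PauliString N) : PauliString N :=
  fun q => if q ∈ s then σ q else .I

/-- The string with the label `p` on the qubit `q` and trivial elsewhere. -/
def single (q : Fin N) (p : Pauli) : PauliString N := Function.update (fun _ => .I) q p

theorem mem_supp {σ : PauliString N} {q : Fin N} : q ∈ σ.supp ↔ σ q ≠ .I := by
  simp [supp]

theorem commSign_eq_one_or_neg_one (σ τ : PauliString N) :
    commSign σ τ = 1 ∨ commSign σ τ = -1 := by
  refine Finset.prod_induction _ (fun z : ℤ => z = 1 ∨ z = -1) ?_ (Or.inl rfl)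
    fun q _ => Pauli.commSign_eq_one_or_neg_one _ _
  rintro a b (rfl | rfl) (rfl | rfl) <;> simp

theorem commSign_single (q : Fin N) (p : Pauli) (σ : PauliString N) :
    commSign (single q p) σ = p.commSign (σ q) := by
  rw [commSign, Finset.prod_eq_single q]
  · simp [single]
  · intro r _ hr
    simp [single, hr, Pauli.commSign_I_left]
  · simp

theorem single_of_ne {q r : Fin N} (h : r ≠ q) (p : Pauli) : single q p r = .I := by
  simp [single, h]

theorem restrict_of_mem {s : Finset (Fin N)} {q : Fin N} (hq : q ∈ s) (σ : PauliString N) :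
    restrict s σ q = σ q := if_pos hq

theorem restrict_of_notMem {s : Finset (Fin N)} {q : Fin N} (hq : q ∉ s) (σ : PauliString N) :
    restrict s σ q = .I := if_neg hq

theorem commSign_restrict {s : Finset (Fin N)} {σ τ : PauliString N}
    (h : ∀ q, q ∉ s → σ q = τ q) :
    commSign (restrict s σ) (restrict s τ) = commSign σ τ := by
  refine Finset.prod_congr rfl fun q _ => ?_
  by_cases hq : q ∈ s
  · rw [restrict_of_mem hq, restrict_of_mem hq]
  · rw [restrict_of_notMem hq, restrict_of_notMem hq, h q hq, Pauli.commSign_self,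
      Pauli.commSign_self]

theorem toOp_eq_piKronecker (σ : PauliString N) :
    σ.toOp = piKronecker fun q => (σ q).toMatrix := rfl

theorem toOp_mul_self (σ : PauliString N) : σ.toOp * σ.toOp = 1 := by
  simp only [toOp_eq_piKronecker, piKronecker_mul, Pauli.toMatrix_mul_self, piKronecker_one]

theorem toOp_mul_comm (σ τ : PauliString N) :
    σ.toOp * τ.toOp = (commSign σ τ : ℂ) • (τ.toOp * σ.toOp) := by
  simp only [toOp_eq_piKronecker, piKronecker_mul, commSign, Int.cast_prod, ← piKronecker_smul,
    ← Pauli.toMatrix_mul_comm]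

theorem toOp_mul_eq_neg {σ τ : PauliString N} (h : commSign σ τ = -1) :
    σ.toOp * τ.toOp = -(τ.toOp * σ.toOp) := by
  rw [toOp_mul_comm, h, Int.cast_neg, Int.cast_one, neg_one_smul]

theorem toOp_conj (ω σ : PauliString N) :
    ω.toOp * σ.toOp * ω.toOp = (commSign ω σ : ℂ) • σ.toOp := by
  rw [toOp_mul_comm, Matrix.smul_mul, Matrix.mul_assoc, toOp_mul_self, Matrix.mul_one]

theorem conjTranspose_toOp (σ : PauliString N) : σ.toOp.conjTranspose = σ.toOp := by
  simp only [toOp_eq_piKronecker, conjTranspose_piKronecker, Pauli.conjTranspose_toMatrix]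

theorem toOp_mem_unitaryGroup (σ : PauliString N) :
    σ.toOp ∈ Matrix.unitaryGroup (Bits (Fin N)) ℂ := by
  rw [Matrix.mem_unitaryGroup_iff, Matrix.star_eq_conjTranspose, conjTranspose_toOp, toOp_mul_self]

theorem toOp_restrict_mul_toOp_restrict_compl (s : Finset (Fin N)) (σ : PauliString N) :
    (restrict s σ).toOp * (restrict sᶜ σ).toOp = σ.toOp := by
  simp only [toOp_eq_piKronecker, piKronecker_mul]
  congr 1
  funext q
  by_cases hq : q ∈ s <;> simp [restrict, hq, Pauli.toMatrix]

theorem trace_toOp_mul (σ τ : PauliString N) :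
    (σ.toOp * τ.toOp).trace = if σ = τ then (2 : ℂ) ^ N else 0 := by
  simp only [toOp_eq_piKronecker, piKronecker_mul, trace_piKronecker, Pauli.trace_toMatrix_mul]
  split_ifs with h
  · simp [h]
  · obtain ⟨q, hq⟩ := Function.ne_iff.1 h
    exact Finset.prod_eq_zero (Finset.mem_univ q) (if_neg hq)

theorem sum_toOp_mul_toOp (w x y z : Bits (Fin N)) :
    ∑ σ : PauliString N, σ.toOp w x * σ.toOp y z =
      if w = z ∧ x = y then (2 : ℂ) ^ N else 0 := by
  simp only [toOp_eq_piKronecker, piKronecker_apply, ← Finset.prod_mul_distrib]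
  rw [← Fintype.prod_sum fun q (a : Pauli) => a.toMatrix (w q) (x q) * a.toMatrix (y q) (z q)]
  simp only [Pauli.sum_toMatrix_mul_toMatrix]
  split_ifs with h
  · simp [h]
  · rw [not_and_or] at h
    rcases h with h | h <;> obtain ⟨q, hq⟩ := Function.ne_iff.1 h <;>
      exact Finset.prod_eq_zero (Finset.mem_univ q) (by simp [hq])

end PauliString

/-! ### Pauli transfer matrices -/

section Transfer

variable {N : ℕ}

/-- The coefficient `2⁻ᴺ tr(τ A)` of an operator `A` along a Pauli string `τ`. -/
noncomputable def coeff (τ : PauliString N) : Op N →ₗ[ℂ] ℂ :=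
  ((2 : ℂ) ^ N)⁻¹ • Matrix.traceLinearMap _ ℂ ℂ ∘ₗ LinearMap.mulLeft ℂ τ.toOp

theorem coeff_apply (τ : PauliString N) (A : Op N) :
    coeff τ A = ((2 : ℂ) ^ N)⁻¹ * (τ.toOp * A).trace := rfl

theorem coeff_toOp (σ τ : PauliString N) : coeff τ σ.toOp = if σ = τ then 1 else 0 := by
  rw [coeff_apply, PauliString.trace_toOp_mul]
  by_cases h : σ = τ
  · simp [h]
  · simp [h, Ne.symm h]

theorem sum_coeff_smul (A : Op N) : ∑ τ, coeff τ A • τ.toOp = A := by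
  ext x y
  have hentry (τ : PauliString N) : coeff τ A * τ.toOp x y =
      ∑ w, ∑ z, ((2 : ℂ) ^ N)⁻¹ * A z w * (τ.toOp w z * τ.toOp x y) := by
    simp only [coeff_apply, Matrix.trace, Matrix.diag, Matrix.mul_apply, Finset.mul_sum,
      Finset.sum_mul]
    exact Finset.sum_congr rfl fun _ _ => Finset.sum_congr rfl fun _ _ => by ring
  calc (∑ τ, coeff τ A • τ.toOp) x y
      = ∑ τ : PauliString N, ∑ w, ∑ z,
          ((2 : ℂ) ^ N)⁻¹ * A z w * (τ.toOp w z * τ.toOp x y) := by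
        simp only [Matrix.sum_apply, Matrix.smul_apply, smul_eq_mul, hentry]
    _ = ∑ w, ∑ z, ((2 : ℂ) ^ N)⁻¹ * A z w * if w = y ∧ z = x then (2 : ℂ) ^ N else 0 := by
        simp only [← PauliString.sum_toOp_mul_toOp, Finset.mul_sum]
        rw [Finset.sum_comm]
        exact Finset.sum_congr rfl fun _ _ => Finset.sum_comm
    _ = A x y := by
        simp only [ite_and, mul_ite, mul_zero, Finset.sum_ite_eq', Finset.mem_univ, if_true,
          Finset.sum_ite_irrel, Finset.sum_const_zero]
        field_simp

theorem sum_coeff_mul_coeff (A B : Op N) :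
    ∑ τ, coeff τ A * coeff τ B = ((2 : ℂ) ^ N)⁻¹ * (A * B).trace := by
  conv_rhs => rw [← sum_coeff_smul A]
  simp only [Finset.sum_mul, Matrix.trace_sum, Finset.mul_sum, Matrix.smul_mul, Matrix.trace_smul]
  refine Finset.sum_congr rfl fun τ _ => ?_
  rw [coeff_apply τ B, smul_eq_mul, mul_left_comm]

theorem ofReal_re_coeff {A : Op N} (hA : A.IsHermitian) (τ : PauliString N) :
    (((coeff τ A).re : ℝ) : ℂ) = coeff τ A := by
  have htrace : (starRingEnd ℂ) (τ.toOp * A).trace = (τ.toOp * A).trace := by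
    rw [starRingEnd_apply, ← Matrix.trace_conjTranspose, Matrix.conjTranspose_mul, hA,
      PauliString.conjTranspose_toOp, Matrix.trace_mul_comm]
  rw [← Complex.conj_eq_iff_re]
  simp only [coeff_apply, map_mul, htrace, map_inv₀, map_pow, Complex.conj_ofNat]

/-- The Pauli transfer matrix of the conjugation `A ↦ E† A E`: the entry `(σ, τ)` is the
coefficient of `E† σ E` along `τ`, which is real. -/
noncomputable def transfer (E : Op N) : Matrix (PauliString N) (PauliString N) ℝ :=
  Matrix.of fun σ τ => (coeff τ (E.conjTranspose * σ.toOp * E)).re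

theorem ofReal_transfer (E : Op N) (σ τ : PauliString N) :
    ((transfer E σ τ : ℝ) : ℂ) = coeff τ (E.conjTranspose * σ.toOp * E) :=
  ofReal_re_coeff (Matrix.isHermitian_conjTranspose_mul_mul E σ.conjTranspose_toOp) τ

theorem sum_transfer_smul (E : Op N) (σ : PauliString N) :
    ∑ τ, ((transfer E σ τ : ℝ) : ℂ) • τ.toOp = E.conjTranspose * σ.toOp * E := by
  simp only [ofReal_transfer, sum_coeff_smul]

theorem continuous_transfer (σ τ : PauliString N) : Continuous fun E : Op N => transfer E σ τ := by
  simp only [transfer, coeff_apply, Matrix.of_apply]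
  fun_prop

theorem transfer_one : transfer (1 : Op N) = 1 := by
  ext σ τ
  apply Complex.ofReal_injective
  rw [ofReal_transfer, Matrix.conjTranspose_one, Matrix.one_mul, Matrix.mul_one, coeff_toOp,
    Matrix.one_apply, apply_ite Complex.ofReal, Complex.ofReal_one, Complex.ofReal_zero]

theorem transfer_mul (E F : Op N) : transfer (E * F) = transfer E * transfer F := by
  ext σ τ
  apply Complex.ofReal_injective
  have hconj : (E * F).conjTranspose * σ.toOp * (E * F) =
      F.conjTranspose * (E.conjTranspose * σ.toOp * E) * F := by
    simp only [Matrix.conjTranspose_mul, Matrix.mul_assoc]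
  rw [ofReal_transfer, hconj, ← sum_transfer_smul, Finset.mul_sum, Finset.sum_mul, map_sum,
    Matrix.mul_apply, Complex.ofReal_sum]
  refine Finset.sum_congr rfl fun ρ _ => ?_
  rw [Complex.ofReal_mul, ofReal_transfer F, Matrix.mul_smul, Matrix.smul_mul, map_smul,
    smul_eq_mul]

theorem transfer_toOp_mul (ω : PauliString N) (E : Op N) (σ τ : PauliString N) :
    transfer (ω.toOp * E) σ τ = ω.commSign σ * transfer E σ τ := by
  apply Complex.ofReal_injective
  have hconj : (ω.toOp * E).conjTranspose * σ.toOp * (ω.toOp * E) =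
      E.conjTranspose * (ω.toOp * σ.toOp * ω.toOp) * E := by
    simp only [Matrix.conjTranspose_mul, PauliString.conjTranspose_toOp, Matrix.mul_assoc]
  rw [Complex.ofReal_mul, ofReal_transfer, ofReal_transfer, hconj, PauliString.toOp_conj,
    Matrix.mul_smul, Matrix.smul_mul, map_smul, smul_eq_mul, Complex.ofReal_intCast]

theorem transfer_mul_eq_transfer_of_conj {F : Op N} {τ τ' : PauliString N} {a : ℝ}
    (hF : F * τ.toOp * F.conjTranspose = (a : ℂ) • τ'.toOp) (E : Op N) (σ : PauliString N) :
    transfer (E * F) σ τ = a * transfer E σ τ' := by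
  apply Complex.ofReal_injective
  have hcycle : (τ.toOp * ((E * F).conjTranspose * σ.toOp * (E * F))).trace =
      (F * τ.toOp * F.conjTranspose * (E.conjTranspose * σ.toOp * E)).trace := by
    calc _ = (τ.toOp * F.conjTranspose * (E.conjTranspose * σ.toOp * E) * F).trace := by
          simp only [Matrix.conjTranspose_mul, Matrix.mul_assoc]
      _ = _ := by rw [Matrix.trace_mul_comm]; simp only [Matrix.mul_assoc]
  rw [Complex.ofReal_mul, ofReal_transfer, ofReal_transfer, coeff_apply, hcycle, hF,
    Matrix.smul_mul, Matrix.trace_smul, coeff_apply, smul_eq_mul, mul_left_comm]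

theorem transfer_mul_toOp (ω : PauliString N) (E : Op N) (σ τ : PauliString N) :
    transfer (E * ω.toOp) σ τ = ω.commSign τ * transfer E σ τ :=
  transfer_mul_eq_transfer_of_conj
    (by rw [PauliString.conjTranspose_toOp, PauliString.toOp_conj, Complex.ofReal_intCast]) E σ

theorem transfer_of_commute_left {E : Op N} (hE : E ∈ Matrix.unitaryGroup (Bits (Fin N)) ℂ)
    {σ : PauliString N} (h : Commute σ.toOp E) (τ : PauliString N) :
    transfer E σ τ = if σ = τ then 1 else 0 := by
  have hconj : E.conjTranspose * σ.toOp * E = σ.toOp := by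
    rw [Matrix.mul_assoc, h.eq, ← Matrix.mul_assoc, ← Matrix.star_eq_conjTranspose,
      Matrix.mem_unitaryGroup_iff'.1 hE, Matrix.one_mul]
  rw [transfer, Matrix.of_apply, hconj, coeff_toOp, apply_ite Complex.re, Complex.one_re,
    Complex.zero_re]

theorem transfer_of_commute_right {E : Op N} (hE : E ∈ Matrix.unitaryGroup (Bits (Fin N)) ℂ)
    (σ : PauliString N) {τ : PauliString N} (h : Commute τ.toOp E) :
    transfer E σ τ = if σ = τ then 1 else 0 := by
  have hconj : E * τ.toOp * E.conjTranspose = ((1 : ℝ) : ℂ) • τ.toOp := by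
    rw [← h.eq, Matrix.mul_assoc, ← Matrix.star_eq_conjTranspose,
      Matrix.mem_unitaryGroup_iff.1 hE, Matrix.mul_one, Complex.ofReal_one, one_smul]
  have htransfer := transfer_mul_eq_transfer_of_conj hconj 1 σ
  rwa [Matrix.one_mul, transfer_one, Matrix.one_apply, one_mul] at htransfer

theorem sum_transfer_sq {E : Op N} (hE : E ∈ Matrix.unitaryGroup (Bits (Fin N)) ℂ)
    (σ : PauliString N) : ∑ τ, transfer E σ τ ^ 2 = 1 := by
  have hEE : E * E.conjTranspose = 1 := Matrix.mem_unitaryGroup_iff.1 hE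
  have hconj : E.conjTranspose * σ.toOp * E * (E.conjTranspose * σ.toOp * E) =
      E.conjTranspose * E := by
    calc _ = E.conjTranspose * σ.toOp * (E * E.conjTranspose) * σ.toOp * E := by
          simp only [Matrix.mul_assoc]
      _ = E.conjTranspose * (σ.toOp * σ.toOp) * E := by
          rw [hEE]; simp only [Matrix.mul_assoc, Matrix.one_mul]
      _ = _ := by rw [PauliString.toOp_mul_self, Matrix.mul_one]
  have htrace : ∑ τ, (transfer E σ τ : ℂ) * transfer E σ τ = 1 := by
    simp only [ofReal_transfer, sum_coeff_mul_coeff, hconj, Matrix.trace_mul_comm _ E, hEE,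
      Matrix.trace_one]
    simp
  exact_mod_cast (by simpa only [sq] using htrace : ∑ τ, (transfer E σ τ : ℂ) ^ 2 = 1)

theorem abs_transfer_le_one {E : Op N} (hE : E ∈ Matrix.unitaryGroup (Bits (Fin N)) ℂ)
    (σ τ : PauliString N) : |transfer E σ τ| ≤ 1 := by
  rw [← sq_le_one_iff_abs_le_one, ← sum_transfer_sq hE σ]
  exact Finset.single_le_sum (f := fun τ => transfer E σ τ ^ 2) (fun _ _ => sq_nonneg _)
    (Finset.mem_univ τ)

end Transfer

/-! ### Local operators -/

section Embed

variable {N : ℕ} (s : Finset (Fin N))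

/-- The splitting of the computational basis into the qubits of `s` and the others. -/
def splitBits : Bits (Fin N) ≃ Bits s × ({q // q ∉ s} → Fin 2) :=
  Equiv.piEquivPiSubtypeProd (fun q => q ∈ s) fun _ => Fin 2

open scoped Kronecker

theorem embed_eq_kronecker (A : Matrix (Bits s) (Bits s) ℂ) :
    embed s A = (A ⊗ₖ (1 : Matrix ({q // q ∉ s} → Fin 2) ({q // q ∉ s} → Fin 2) ℂ)).submatrix
      (splitBits s) (splitBits s) := by
  ext x y
  simp only [embed, Matrix.of_apply, Matrix.submatrix_apply, Matrix.kroneckerMap_apply,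
    Matrix.one_apply, splitBits, Equiv.piEquivPiSubtypeProd_apply, funext_iff, Subtype.forall,
    mul_ite, mul_one, mul_zero]

theorem toOp_eq_kronecker (σ : PauliString N) :
    σ.toOp = (piKronecker (fun q : s => (σ q).toMatrix) ⊗ₖ
      piKronecker (fun q : {q // q ∉ s} => (σ q).toMatrix)).submatrix
        (splitBits s) (splitBits s) := by
  ext x y
  simp only [PauliString.toOp_eq_piKronecker, piKronecker_apply, Matrix.submatrix_apply,
    Matrix.kroneckerMap_apply, splitBits, Equiv.piEquivPiSubtypeProd_apply]
  convert! (Fintype.prod_subtype_mul_prod_subtype (fun q => q ∈ s)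
    (fun q => (σ q).toMatrix (x q) (y q))).symm

/-- The homomorphism `A ↦ A ⊗ I` of star algebras. -/
noncomputable def embedHom : Matrix (Bits s) (Bits s) ℂ →⋆ₐ[ℂ] Op N where
  toFun := embed s
  map_one' := by simp [embed_eq_kronecker]
  map_mul' A B := by
    simp only [embed_eq_kronecker, Matrix.submatrix_mul_equiv, ← Matrix.mul_kronecker_mul,
      Matrix.mul_one]
  map_zero' := by simp [embed_eq_kronecker]
  map_add' A B := by
    simp only [embed_eq_kronecker, Matrix.add_kronecker, Matrix.submatrix_add, Pi.add_apply]
  commutes' a := by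
    simp [embed_eq_kronecker, Algebra.algebraMap_eq_smul_one, Matrix.smul_kronecker,
      Matrix.submatrix_smul]
  map_star' A := by
    simp [embed_eq_kronecker, Matrix.star_eq_conjTranspose, Matrix.conjTranspose_submatrix,
      Matrix.conjTranspose_kronecker]

theorem embedHom_apply (A : Matrix (Bits s) (Bits s) ℂ) : embedHom s A = embed s A := rfl

theorem embed_mul (A B : Matrix (Bits s) (Bits s) ℂ) : embed s (A * B) = embed s A * embed s B :=
  map_mul (embedHom s) A B

theorem embedHom_injective : Function.Injective (embedHom s) := by
  intro A B h
  ext x y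
  have hentry := congrFun₂ h ((splitBits s).symm (x, 0)) ((splitBits s).symm (y, 0))
  simpa [embedHom_apply, embed_eq_kronecker] using hentry

variable {s}

theorem toOp_mem_range_embedHom {ω : PauliString N} (hω : ∀ q, q ∉ s → ω q = .I) :
    ω.toOp ∈ (embedHom s).range := by
  refine ⟨piKronecker fun q : s => (ω q).toMatrix, ?_⟩
  have hone : piKronecker (fun q : {q // q ∉ s} => (ω q).toMatrix) = 1 := by
    simp only [fun q : {q // q ∉ s} => hω q q.2, Pauli.toMatrix, piKronecker_one]
  change embed s _ = _
  rw [embed_eq_kronecker, toOp_eq_kronecker s ω, hone]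

theorem commute_toOp_embed {τ : PauliString N} (hτ : ∀ q ∈ s, τ q = .I)
    (A : Matrix (Bits s) (Bits s) ℂ) : Commute τ.toOp (embed s A) := by
  have hone : piKronecker (fun q : s => (τ q).toMatrix) = 1 := by
    simp only [fun q : s => hτ q q.2, Pauli.toMatrix, piKronecker_one]
  rw [commute_iff_eq, embed_eq_kronecker, toOp_eq_kronecker s τ, hone]
  simp only [Matrix.submatrix_mul_equiv, ← Matrix.mul_kronecker_mul, Matrix.mul_one,
    Matrix.one_mul]

theorem exists_localUnitary {E : Op N} (hE : E ∈ Matrix.unitaryGroup (Bits (Fin N)) ℂ)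
    (hs : E ∈ (embedHom s).range) : ∃ u : LocalUnitary s, embed s u.1 = E := by
  obtain ⟨A, rfl⟩ := hs
  refine ⟨⟨A, Matrix.mem_unitaryGroup_iff.2 (embedHom_injective s ?_)⟩, rfl⟩
  rw [map_mul, map_star, map_one]
  exact Matrix.mem_unitaryGroup_iff.1 hE

theorem embed_mem_unitaryGroup (u : LocalUnitary s) :
    embed s u.1 ∈ Matrix.unitaryGroup (Bits (Fin N)) ℂ := by
  rw [← embedHom_apply, Matrix.mem_unitaryGroup_iff, ← map_star, ← map_mul,
    Matrix.mem_unitaryGroup_iff.1 u.2, map_one]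

theorem continuous_transfer_embed (σ τ : PauliString N) :
    Continuous fun u : LocalUnitary s => transfer (embed s u.1) σ τ := by
  refine (continuous_transfer σ τ).comp (continuous_matrix fun x y => ?_)
  simp only [embed, Matrix.of_apply]
  split_ifs
  · exact continuous_subtype_val.matrix_elem _ _
  · exact continuous_const

theorem transfer_embed_of_trivial_left (u : LocalUnitary s) {σ : PauliString N}
    (hσ : ∀ q ∈ s, σ q = .I) (τ : PauliString N) :
    transfer (embed s u.1) σ τ = if σ = τ then 1 else 0 :=
  transfer_of_commute_left (embed_mem_unitaryGroup u) (commute_toOp_embed hσ _) τ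

theorem transfer_embed_of_trivial_right (u : LocalUnitary s) (σ : PauliString N)
    {τ : PauliString N} (hτ : ∀ q ∈ s, τ q = .I) :
    transfer (embed s u.1) σ τ = if σ = τ then 1 else 0 :=
  transfer_of_commute_right (embed_mem_unitaryGroup u) σ (commute_toOp_embed hτ _)

theorem transfer_embed_eq_zero (u : LocalUnitary s) {σ τ : PauliString N} {q : Fin N}
    (hq : q ∉ s) (h : σ q ≠ τ q) : transfer (embed s u.1) σ τ = 0 := by
  obtain ⟨p, hp⟩ := Pauli.exists_commSign_mul_eq_neg_one h
  have hcomm : Commute (PauliString.single q p).toOp (embed s u.1) :=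
    commute_toOp_embed (fun r hr => PauliString.single_of_ne (ne_of_mem_of_not_mem hr hq) p) _
  have hsign : (p.commSign (σ q) : ℝ) * transfer (embed s u.1) σ τ =
      p.commSign (τ q) * transfer (embed s u.1) σ τ := by
    simp only [← PauliString.commSign_single, ← transfer_toOp_mul, ← transfer_mul_toOp, hcomm.eq]
  rcases Int.mul_eq_neg_one_iff_eq_one_or_neg_one.1 hp with ⟨h1, h2⟩ | ⟨h1, h2⟩ <;>
    rw [h1, h2] at hsign <;> push_cast at hsign <;> linarith

end Embed

/-! ### Strings with prescribed values outside a set -/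

section Agree

variable {N : ℕ} (s : Finset (Fin N))

/-- The strings which agree with `σ` outside `s`. -/
def agreeOff (σ : PauliString N) : Finset (PauliString N) :=
  Fintype.piFinset fun q => if q ∈ s then Finset.univ else {σ q}

/-- The strings which agree with `σ` outside `s` and are nontrivial on `s`. -/
def nontrivialClass (σ : PauliString N) : Finset (PauliString N) :=
  (agreeOff s σ).filter fun τ => ∃ q ∈ s, τ q ≠ Pauli.I

variable {s}

theorem mem_agreeOff {σ τ : PauliString N} : τ ∈ agreeOff s σ ↔ ∀ q, q ∉ s → τ q = σ q := by
  simp only [agreeOff, Fintype.mem_piFinset]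
  refine forall_congr' fun q => ?_
  by_cases hq : q ∈ s <;> simp [hq]

theorem mem_nontrivialClass {σ τ : PauliString N} :
    τ ∈ nontrivialClass s σ ↔ (∀ q, q ∉ s → τ q = σ q) ∧ ∃ q ∈ s, τ q ≠ Pauli.I := by
  rw [nontrivialClass, Finset.mem_filter, mem_agreeOff]

theorem nontrivialClass_congr {σ τ : PauliString N} (h : ∀ q, q ∉ s → τ q = σ q) :
    nontrivialClass s τ = nontrivialClass s σ := by
  ext ρ
  simp only [mem_nontrivialClass]
  exact and_congr_left' (forall₂_congr fun q hq => by rw [h q hq])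

variable (s)

theorem card_agreeOff (σ : PauliString N) : (agreeOff s σ).card = 4 ^ s.card := by
  simp [agreeOff, Fintype.card_piFinset, apply_ite Finset.card, Finset.prod_ite_mem,
    Pauli.card_eq_four]

theorem card_nontrivialClass (σ : PauliString N) :
    (nontrivialClass s σ).card = 4 ^ s.card - 1 := by
  have htriv : nontrivialClass s σ = (agreeOff s σ).erase (σ.restrict sᶜ) := by
    ext τ
    rw [Finset.mem_erase, mem_nontrivialClass, mem_agreeOff, and_comm, and_congr_left_iff]
    refine fun hτ => ⟨?_, fun hne => ?_⟩
    · rintro ⟨q, hq, hI⟩ rfl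
      exact hI (PauliString.restrict_of_notMem (by simpa using hq) σ)
    · obtain ⟨q, hq⟩ := Function.ne_iff.1 hne
      by_cases hqs : q ∈ s
      · exact ⟨q, hqs, by rwa [PauliString.restrict_of_notMem (by simpa using hqs)] at hq⟩
      · exact absurd (hτ q hqs) (by rwa [PauliString.restrict_of_mem (by simpa using hqs)] at hq)
  rw [htriv, Finset.card_erase_of_mem, card_agreeOff]
  exact mem_agreeOff.2 fun q hq => PauliString.restrict_of_mem (by simpa using hq) σ

variable {s}

theorem sum_agreeOff_prod {R : Type*} [CommSemiring R] (σ : PauliString N)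
    (f : Fin N → Pauli → R) :
    ∑ τ ∈ agreeOff s σ, ∏ q, f q (τ q) = ∏ q, if q ∈ s then ∑ p, f q p else f q (σ q) := by
  rw [agreeOff, ← Finset.prod_univ_sum]
  refine Finset.prod_congr rfl fun q _ => ?_
  split_ifs <;> simp

theorem sum_agreeOff_commSign {τ : PauliString N} (hτ : ∃ q ∈ s, τ q ≠ .I)
    (σ : PauliString N) : ∑ ω ∈ agreeOff s σ, ω.commSign τ = 0 := by
  obtain ⟨q, hq, hI⟩ := hτ
  simp only [PauliString.commSign]
  rw [sum_agreeOff_prod (f := fun q p => p.commSign (τ q))]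
  exact Finset.prod_eq_zero (Finset.mem_univ q) (by rw [if_pos hq, Pauli.sum_commSign hI])

theorem sum_agreeOff_commSign_mul_commSign_nonneg {σ τ τ' : PauliString N}
    (h : ∀ q, q ∉ s → τ q = τ' q) :
    0 ≤ ∑ ω ∈ agreeOff s σ, ω.commSign τ * ω.commSign τ' := by
  simp only [PauliString.commSign, ← Finset.prod_mul_distrib]
  rw [sum_agreeOff_prod (f := fun q p => p.commSign (τ q) * p.commSign (τ' q))]
  refine Finset.prod_nonneg fun q _ => ?_
  split_ifs with hq
  · exact Pauli.sum_commSign_mul_commSign_nonneg _ _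
  · rw [h q hq]
    exact mul_self_nonneg _

theorem exists_common_anticommuting {σ τ τ' : PauliString N} (hτ : τ ∈ nontrivialClass s σ)
    (hτ' : τ' ∈ nontrivialClass s σ) :
    ∃ ω ∈ agreeOff s σ, ω.commSign τ = -1 ∧ ω.commSign τ' = -1 := by
  rw [mem_nontrivialClass] at hτ hτ'
  by_contra! hnone
  have hzero : ∀ ω ∈ agreeOff s σ, (1 - ω.commSign τ) * (1 - ω.commSign τ') = 0 := by
    intro ω hω
    rcases ω.commSign_eq_one_or_neg_one τ with h | h
    · rw [h, sub_self, zero_mul]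
    · rw [(ω.commSign_eq_one_or_neg_one τ').resolve_right (hnone ω hω h), sub_self, mul_zero]
  have hexpand : ∑ ω ∈ agreeOff s σ, (1 - ω.commSign τ) * (1 - ω.commSign τ') =
      4 ^ s.card + ∑ ω ∈ agreeOff s σ, ω.commSign τ * ω.commSign τ' := by
    have hsplit : ∀ a b : ℤ, (1 - a) * (1 - b) = 1 - a - b + a * b := fun a b => by ring
    simp [hsplit, Finset.sum_add_distrib, Finset.sum_sub_distrib, sum_agreeOff_commSign hτ.2,
      sum_agreeOff_commSign hτ'.2, card_agreeOff]
  rw [Finset.sum_eq_zero hzero] at hexpand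
  have hnonneg := sum_agreeOff_commSign_mul_commSign_nonneg (σ := σ) (s := s)
    fun q hq => (hτ.1 q hq).trans (hτ'.1 q hq).symm
  have hpos : (0 : ℤ) < 4 ^ s.card := by positivity
  omega

theorem two_mul_card_filter_commSign_eq_neg_one {Ω : PauliString N} (hΩ : ∃ q ∈ s, Ω q ≠ .I)
    (σ : PauliString N) :
    2 * ((agreeOff s σ).filter fun τ => τ.commSign Ω = -1).card = 4 ^ s.card := by
  have hsign : ∀ τ : PauliString N, τ.commSign Ω = 1 - 2 * if τ.commSign Ω = -1 then 1 else 0 := by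
    intro τ
    rcases τ.commSign_eq_one_or_neg_one Ω with h | h <;> simp [h]
  have hsum := sum_agreeOff_commSign hΩ σ
  rw [Finset.sum_congr rfl fun τ _ => hsign τ, Finset.sum_sub_distrib, ← Finset.mul_sum,
    Finset.sum_boole, Finset.sum_const, card_agreeOff] at hsum
  simp only [nsmul_eq_mul, mul_one] at hsum
  zify
  push_cast at hsum
  linarith

end Agree

/-! ### Second moments of unitary designs -/

section Haar

variable {n : Type} [Fintype n] [DecidableEq n]

instance : IsProbabilityMeasure (haarUnitary n) :=
  ⟨Measure.haarMeasure_self⟩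

instance : (haarUnitary n).IsHaarMeasure := by unfold haarUnitary; infer_instance

instance : (haarUnitary n).IsMulRightInvariant where
  map_mul_right_eq_self g := by
    have : IsProbabilityMeasure ((haarUnitary n).map (· * g)) :=
      Measure.isProbabilityMeasure_map (measurable_mul_const g).aemeasurable
    exact Measure.isHaarMeasure_eq_of_isProbabilityMeasure _ _

/-- The functions `U ↦ U i j * star (U k l)` of a unitary `U`. -/
noncomputable def entryForm (i j k l : n) : C(Matrix.unitaryGroup n ℂ, ℂ) where
  toFun U := U.1 i j * star (U.1 k l)
  continuous_toFun := (continuous_subtype_val.matrix_elem i j).mul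
    (continuous_subtype_val.matrix_elem k l).star

variable (n) in
/-- The span of the functions `U ↦ U i j * star (U k l)`; the products of two of its elements are
the functions whose integrals are prescribed by the `2`-design property. -/
noncomputable def entryForms : Submodule ℂ C(Matrix.unitaryGroup n ℂ, ℂ) :=
  Submodule.span ℂ (Set.range fun p : n × n × n × n => entryForm p.1 p.2.1 p.2.2.1 p.2.2.2)

theorem entryForm_mem_entryForms (i j k l : n) : entryForm i j k l ∈ entryForms n :=
  Submodule.subset_span ⟨(i, j, k, l), rfl⟩

theorem IsUnitaryDesign.integral_mul_eq {ν : Measure (Matrix.unitaryGroup n ℂ)}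
    (hν : IsUnitaryDesign 2 ν) {f g : C(Matrix.unitaryGroup n ℂ, ℂ)} (hf : f ∈ entryForms n)
    (hg : g ∈ entryForms n) : ∫ U, f U * g U ∂ν = ∫ U, f U * g U ∂(haarUnitary n) := by
  have := hν.1
  have hint : ∀ (ρ : Measure (Matrix.unitaryGroup n ℂ)) [IsProbabilityMeasure ρ]
      (φ : C(Matrix.unitaryGroup n ℂ, ℂ)), Integrable φ ρ := fun ρ _ φ =>
    φ.continuous.integrable_of_hasCompactSupport (HasCompactSupport.of_compactSpace φ)
  have hmem : f * g ∈ entryForms n * entryForms n := Submodule.mul_mem_mul hf hg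
  rw [entryForms, Submodule.span_mul_span] at hmem
  simp only [← ContinuousMap.mul_apply]
  generalize f * g = φ at hmem ⊢
  induction hmem using Submodule.span_induction with
  | mem φ hφ =>
    obtain ⟨_, ⟨p, rfl⟩, _, ⟨p', rfl⟩, rfl⟩ := Set.mem_mul.1 hφ
    simpa only [Fin.prod_univ_two, Matrix.cons_val_zero, Matrix.cons_val_one, entryForm,
      ContinuousMap.mul_apply, ContinuousMap.coe_mk, mul_mul_mul_comm] using
      hν.2 ![p.1, p'.1] ![p.2.1, p'.2.1] ![p.2.2.1, p'.2.2.1] ![p.2.2.2, p'.2.2.2]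
  | zero => simp
  | add φ ψ _ _ hφ hψ =>
    simp only [ContinuousMap.add_apply]
    rw [integral_add (hint ν φ) (hint ν ψ), integral_add (hint _ φ) (hint _ ψ), hφ, hψ]
  | smul a φ _ hφ =>
    simp only [ContinuousMap.smul_apply, integral_smul, hφ]

end Haar

section Design

variable {N : ℕ} {s : Finset (Fin N)}

theorem exists_mem_entryForms_eq_transfer (σ τ : PauliString N) :
    ∃ f ∈ entryForms (Bits s), ∀ u : LocalUnitary s,
      f u = (transfer (embed s u.1) σ τ : ℂ) := by
  classical
  let δ : Bits (Fin N) → Bits (Fin N) → ℂ := fun x y => if ∀ q, q ∉ s → x q = y q then 1 else 0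
  have hembed : ∀ (A : Matrix (Bits s) (Bits s) ℂ) (x y : Bits (Fin N)),
      embed s A x y = δ x y * A (fun q => x q) (fun q => y q) := by
    intro A x y
    simp only [embed, Matrix.of_apply, δ, ite_mul, one_mul, zero_mul]
  refine ⟨((2 : ℂ) ^ N)⁻¹ • ∑ x, ∑ y, ∑ z, ∑ w,
    (τ.toOp x y * (star (δ w y) * σ.toOp w z * δ z x)) •
    entryForm (fun q : s => z q) (fun q => x q) (fun q => w q) (fun q => y q), ?_, fun u => ?_⟩
  · exact Submodule.smul_mem _ _ (Submodule.sum_mem _ fun x _ => Submodule.sum_mem _ fun y _ =>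
      Submodule.sum_mem _ fun z _ => Submodule.sum_mem _ fun w _ =>
        Submodule.smul_mem _ _ (entryForm_mem_entryForms _ _ _ _))
  · rw [ofReal_transfer, coeff_apply]
    simp only [ContinuousMap.smul_apply, ContinuousMap.sum_apply, entryForm,
      ContinuousMap.coe_mk, Matrix.trace, Matrix.diag, Matrix.mul_apply,
      Matrix.conjTranspose_apply, hembed, star_mul', Finset.mul_sum, Finset.sum_mul, smul_eq_mul]
    refine Finset.sum_congr rfl fun x _ => Finset.sum_congr rfl fun y _ =>
      Finset.sum_congr rfl fun z _ => Finset.sum_congr rfl fun w _ => ?_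
    ring

theorem integral_transfer_mul_transfer_eq_haar {ν : Measure (LocalUnitary s)}
    (hν : IsUnitaryDesign 2 ν) (σ τ σ' τ' : PauliString N) :
    ∫ u, transfer (embed s u.1) σ τ * transfer (embed s u.1) σ' τ' ∂ν =
      ∫ u, transfer (embed s u.1) σ τ * transfer (embed s u.1) σ' τ' ∂(haarUnitary (Bits s)) := by
  obtain ⟨f, hf, hf_eq⟩ := exists_mem_entryForms_eq_transfer (s := s) σ τ
  obtain ⟨g, hg, hg_eq⟩ := exists_mem_entryForms_eq_transfer (s := s) σ' τ'
  apply Complex.ofReal_injective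
  simpa only [← integral_complex_ofReal, Complex.ofReal_mul, hf_eq, hg_eq] using
    hν.integral_mul_eq hf hg

theorem exists_embed_eq_toOp {ω : PauliString N} (hω : ∀ q, q ∉ s → ω q = .I) :
    ∃ v : LocalUnitary s, embed s v.1 = ω.toOp :=
  exists_localUnitary ω.toOp_mem_unitaryGroup (toOp_mem_range_embedHom hω)

theorem integral_haar_transfer_mul_of_left_ne {σ σ' : PauliString N} {q : Fin N} (hq : q ∈ s)
    (h : σ q ≠ σ' q) (τ τ' : PauliString N) :
    ∫ u, transfer (embed s u.1) σ τ * transfer (embed s u.1) σ' τ' ∂(haarUnitary (Bits s)) = 0 := by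
  obtain ⟨p, hp⟩ := Pauli.exists_commSign_mul_eq_neg_one h
  obtain ⟨v, hv⟩ := exists_embed_eq_toOp (s := s) (ω := PauliString.single q p)
    fun r hr => PauliString.single_of_ne (ne_of_mem_of_not_mem hq hr).symm p
  have hflip : ∀ u : LocalUnitary s, transfer (embed s (v * u).1) σ τ *
      transfer (embed s (v * u).1) σ' τ' =
      -(transfer (embed s u.1) σ τ * transfer (embed s u.1) σ' τ') := by
    intro u
    have hp' : (p.commSign (σ q) : ℝ) * p.commSign (σ' q) = -1 := by exact_mod_cast hp
    rw [Submonoid.coe_mul, embed_mul, hv, transfer_toOp_mul, transfer_toOp_mul,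
      PauliString.commSign_single, PauliString.commSign_single, mul_mul_mul_comm, hp', neg_one_mul]
  have hinv := integral_mul_left_eq_self (μ := haarUnitary (Bits s))
    (fun u : LocalUnitary s => transfer (embed s u.1) σ τ * transfer (embed s u.1) σ' τ') v
  simp only [hflip, integral_neg] at hinv
  linarith

theorem integral_haar_transfer_mul_of_right_ne {τ τ' : PauliString N} {q : Fin N} (hq : q ∈ s)
    (h : τ q ≠ τ' q) (σ σ' : PauliString N) :
    ∫ u, transfer (embed s u.1) σ τ * transfer (embed s u.1) σ' τ' ∂(haarUnitary (Bits s)) = 0 := by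
  obtain ⟨p, hp⟩ := Pauli.exists_commSign_mul_eq_neg_one h
  obtain ⟨v, hv⟩ := exists_embed_eq_toOp (s := s) (ω := PauliString.single q p)
    fun r hr => PauliString.single_of_ne (ne_of_mem_of_not_mem hq hr).symm p
  have hflip : ∀ u : LocalUnitary s, transfer (embed s (u * v).1) σ τ *
      transfer (embed s (u * v).1) σ' τ' =
      -(transfer (embed s u.1) σ τ * transfer (embed s u.1) σ' τ') := by
    intro u
    have hp' : (p.commSign (τ q) : ℝ) * p.commSign (τ' q) = -1 := by exact_mod_cast hp
    rw [Submonoid.coe_mul, embed_mul, hv, transfer_mul_toOp, transfer_mul_toOp,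
      PauliString.commSign_single, PauliString.commSign_single, mul_mul_mul_comm, hp', neg_one_mul]
  have hinv := integral_mul_right_eq_self (μ := haarUnitary (Bits s))
    (fun u : LocalUnitary s => transfer (embed s u.1) σ τ * transfer (embed s u.1) σ' τ') v
  simp only [hflip, integral_neg] at hinv
  linarith

theorem transfer_embed_eq_zero_of_notMem (u : LocalUnitary s) {σ τ : PauliString N}
    (hσ : ∃ q ∈ s, σ q ≠ Pauli.I) (hτ : τ ∉ nontrivialClass s σ) :
    transfer (embed s u.1) σ τ = 0 := by
  by_cases hoff : ∀ q, q ∉ s → τ q = σ q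
  · have htriv : ∀ q ∈ s, τ q = .I := by
      by_contra! hne
      exact hτ (mem_nontrivialClass.2 ⟨hoff, hne⟩)
    rw [transfer_embed_of_trivial_right u σ htriv, if_neg]
    rintro rfl
    obtain ⟨q, hq, hI⟩ := hσ
    exact hI (htriv q hq)
  · push Not at hoff
    obtain ⟨q, hq, hne⟩ := hoff
    exact transfer_embed_eq_zero u hq hne.symm

/-- The unitary `(ρ + ρ') / √2`, which exchanges the anticommuting strings `ρ` and `ρ'`. -/
noncomputable def swapOp (ρ ρ' : PauliString N) : Op N :=
  ((√2 : ℝ) : ℂ)⁻¹ • (ρ.toOp + ρ'.toOp)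

theorem conjTranspose_swapOp (ρ ρ' : PauliString N) :
    (swapOp ρ ρ').conjTranspose = swapOp ρ ρ' := by
  simp [swapOp, Matrix.conjTranspose_smul, Matrix.conjTranspose_add,
    PauliString.conjTranspose_toOp]

theorem inv_sqrt_two_mul_self : ((√2 : ℝ) : ℂ)⁻¹ * ((√2 : ℝ) : ℂ)⁻¹ = 2⁻¹ := by
  rw [← mul_inv, ← Complex.ofReal_mul, Real.mul_self_sqrt zero_le_two, Complex.ofReal_ofNat]

theorem swapOp_mul_self {ρ ρ' : PauliString N} (h : ρ.commSign ρ' = -1) :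
    swapOp ρ ρ' * swapOp ρ ρ' = 1 := by
  rw [swapOp, smul_mul_smul_comm, inv_sqrt_two_mul_self, mul_add, add_mul, add_mul,
    PauliString.toOp_mul_self, PauliString.toOp_mul_self, PauliString.toOp_mul_eq_neg h]
  module

theorem swapOp_mul_toOp (ρ ρ' : PauliString N) :
    swapOp ρ ρ' * ρ.toOp = ρ'.toOp * swapOp ρ ρ' := by
  rw [swapOp, smul_mul_assoc, mul_smul_comm, add_mul, mul_add, PauliString.toOp_mul_self,
    PauliString.toOp_mul_self, add_comm]

theorem exists_conj_toOp_eq {τ τ' : PauliString N} (hoff : ∀ q, q ∉ s → τ q = τ' q)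
    (h : τ.commSign τ' = -1) :
    ∃ v : LocalUnitary s, embed s v.1 * τ.toOp * (embed s v.1).conjTranspose = τ'.toOp := by
  set ρ := τ.restrict s with hρ
  set ρ' := τ'.restrict s
  have hsign : ρ.commSign ρ' = -1 := (PauliString.commSign_restrict hoff).trans h
  have hcompl : τ.restrict sᶜ = τ'.restrict sᶜ := by
    funext q
    by_cases hq : q ∈ s <;> simp [PauliString.restrict, hq, hoff]
  have hlocal : swapOp ρ ρ' ∈ (embedHom s).range :=
    Subalgebra.smul_mem _ (add_mem
      (toOp_mem_range_embedHom fun q hq => PauliString.restrict_of_notMem hq τ)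
      (toOp_mem_range_embedHom fun q hq => PauliString.restrict_of_notMem hq τ')) _
  obtain ⟨v, hv⟩ := exists_localUnitary (Matrix.mem_unitaryGroup_iff.2
    (by rw [Matrix.star_eq_conjTranspose, conjTranspose_swapOp, swapOp_mul_self hsign])) hlocal
  have hcomm : Commute (τ'.restrict sᶜ).toOp (swapOp ρ ρ') := hv ▸ commute_toOp_embed
    (fun q hq => PauliString.restrict_of_notMem (by simpa using hq) τ') v.1
  refine ⟨v, ?_⟩
  rw [hv, conjTranspose_swapOp]
  calc swapOp ρ ρ' * τ.toOp * swapOp ρ ρ'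
      = swapOp ρ ρ' * ρ.toOp * ((τ'.restrict sᶜ).toOp * swapOp ρ ρ') := by
        rw [← PauliString.toOp_restrict_mul_toOp_restrict_compl s τ, hcompl]
        simp only [Matrix.mul_assoc, hρ]
    _ = ρ'.toOp * (swapOp ρ ρ' * swapOp ρ ρ') * (τ'.restrict sᶜ).toOp := by
        rw [swapOp_mul_toOp, hcomm.eq]
        simp only [Matrix.mul_assoc]
    _ = τ'.toOp := by
        rw [swapOp_mul_self hsign, Matrix.mul_one,
          PauliString.toOp_restrict_mul_toOp_restrict_compl]

theorem integral_haar_transfer_sq_eq_of_anticommuting {τ τ' : PauliString N}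
    (hoff : ∀ q, q ∉ s → τ q = τ' q) (h : τ.commSign τ' = -1) (σ : PauliString N) :
    ∫ u, transfer (embed s u.1) σ τ ^ 2 ∂(haarUnitary (Bits s)) =
      ∫ u, transfer (embed s u.1) σ τ' ^ 2 ∂(haarUnitary (Bits s)) := by
  obtain ⟨v, hv⟩ := exists_conj_toOp_eq hoff h
  rw [← integral_mul_right_eq_self (fun u : LocalUnitary s => transfer (embed s u.1) σ τ ^ 2) v]
  simp only [Submonoid.coe_mul, embed_mul, transfer_mul_eq_transfer_of_conj (a := 1)
    (by rw [hv, Complex.ofReal_one, one_smul]), one_mul]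

theorem integral_haar_transfer_sq_eq {σ τ τ' : PauliString N} (hτ : τ ∈ nontrivialClass s σ)
    (hτ' : τ' ∈ nontrivialClass s σ) :
    ∫ u, transfer (embed s u.1) σ τ ^ 2 ∂(haarUnitary (Bits s)) =
      ∫ u, transfer (embed s u.1) σ τ' ^ 2 ∂(haarUnitary (Bits s)) := by
  obtain ⟨ω, hω, h, h'⟩ := exists_common_anticommuting hτ hτ'
  rw [mem_nontrivialClass] at hτ hτ'
  rw [mem_agreeOff] at hω
  rw [← integral_haar_transfer_sq_eq_of_anticommuting
      (fun q hq => (hω q hq).trans (hτ.1 q hq).symm) h,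
    integral_haar_transfer_sq_eq_of_anticommuting
      (fun q hq => (hω q hq).trans (hτ'.1 q hq).symm) h']

theorem integral_haar_transfer_sq {σ τ : PauliString N} (hσ : ∃ q ∈ s, σ q ≠ Pauli.I)
    (hτ : τ ∈ nontrivialClass s σ) :
    ∫ u, transfer (embed s u.1) σ τ ^ 2 ∂(haarUnitary (Bits s)) = ((4 : ℝ) ^ s.card - 1)⁻¹ := by
  have hrow : ∀ u : LocalUnitary s,
      ∑ ρ ∈ nontrivialClass s σ, transfer (embed s u.1) σ ρ ^ 2 = 1 := by
    intro u
    rw [← sum_transfer_sq (embed_mem_unitaryGroup u) σ]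
    refine Finset.sum_subset (Finset.subset_univ _) fun ρ _ hρ => ?_
    rw [transfer_embed_eq_zero_of_notMem u hσ hρ, zero_pow two_ne_zero]
  have hsum : ∑ ρ ∈ nontrivialClass s σ,
      ∫ u, transfer (embed s u.1) σ ρ ^ 2 ∂(haarUnitary (Bits s)) = 1 := by
    rw [← integral_finsetSum]
    · simp [hrow]
    · exact fun ρ _ => ((continuous_transfer_embed σ ρ).pow 2).integrable_of_hasCompactSupport
        (HasCompactSupport.of_compactSpace _)
  rw [Finset.sum_congr rfl fun ρ hρ => integral_haar_transfer_sq_eq hρ hτ, Finset.sum_const,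
    card_nontrivialClass, nsmul_eq_mul, Nat.cast_sub (Nat.one_le_pow _ _ (by norm_num))] at hsum
  push_cast at hsum
  exact eq_inv_of_mul_eq_one_right hsum

variable {X : Type*} [MeasurableSpace X] {π : Measure X} {u : X → LocalUnitary s}

theorem integral_transfer_mul_transfer (hu : Measurable u) (hd : IsUnitaryDesign 2 (π.map u))
    (σ τ σ' τ' : PauliString N) :
    ∫ x, transfer (embed s (u x).1) σ τ * transfer (embed s (u x).1) σ' τ' ∂π =
      ∫ v, transfer (embed s v.1) σ τ * transfer (embed s v.1) σ' τ' ∂(haarUnitary (Bits s)) := by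
  rw [← integral_transfer_mul_transfer_eq_haar hd, integral_map hu.aemeasurable]
  exact ((continuous_transfer_embed σ τ).mul
    (continuous_transfer_embed σ' τ')).aestronglyMeasurable

theorem integral_transfer_mul_of_left_ne (hu : Measurable u) (hd : IsUnitaryDesign 2 (π.map u))
    {σ σ' : PauliString N} {q : Fin N} (hq : q ∈ s) (h : σ q ≠ σ' q) (τ τ' : PauliString N) :
    ∫ x, transfer (embed s (u x).1) σ τ * transfer (embed s (u x).1) σ' τ' ∂π = 0 := by
  rw [integral_transfer_mul_transfer hu hd, integral_haar_transfer_mul_of_left_ne hq h]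

theorem integral_transfer_mul_of_nontrivial (hu : Measurable u) (hd : IsUnitaryDesign 2 (π.map u))
    {σ : PauliString N} (hσ : ∃ q ∈ s, σ q ≠ Pauli.I) (τ τ' : PauliString N) :
    ∫ x, transfer (embed s (u x).1) σ τ * transfer (embed s (u x).1) σ τ' ∂π =
      if τ = τ' ∧ τ ∈ nontrivialClass s σ then ((4 : ℝ) ^ s.card - 1)⁻¹ else 0 := by
  rw [integral_transfer_mul_transfer hu hd]
  by_cases hτ : τ ∈ nontrivialClass s σ
  swap
  · simp [transfer_embed_eq_zero_of_notMem _ hσ hτ, hτ]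
  by_cases hτ' : τ' ∈ nontrivialClass s σ
  swap
  · rw [if_neg (by rintro ⟨rfl, h⟩; exact hτ' h)]
    simp [transfer_embed_eq_zero_of_notMem _ hσ hτ']
  obtain rfl | hne := eq_or_ne τ τ'
  · simp only [← sq, integral_haar_transfer_sq hσ hτ, hτ, and_self, if_true]
  · obtain ⟨q, hq⟩ := Function.ne_iff.1 hne
    have hqs : q ∈ s := by
      by_contra hqs
      exact hq <| ((mem_nontrivialClass.1 hτ).1 q hqs).trans
        ((mem_nontrivialClass.1 hτ').1 q hqs).symm
    rw [integral_haar_transfer_mul_of_right_ne hqs hq, if_neg (hne ·.1)]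

theorem integral_transfer_of_nontrivial (hu : Measurable u) (hd : IsUnitaryDesign 2 (π.map u))
    {σ : PauliString N} (hσ : ∃ q ∈ s, σ q ≠ Pauli.I) (τ : PauliString N) :
    ∫ x, transfer (embed s (u x).1) σ τ ∂π = 0 := by
  obtain ⟨q, hq, h⟩ := hσ
  rw [← integral_transfer_mul_of_left_ne hu hd hq (σ' := fun _ => Pauli.I) h τ
    (fun _ => Pauli.I)]
  simp [transfer_embed_of_trivial_left]

end Design

/-! ### Pauli rotations -/

section Rotation

variable {N : ℕ} {Ω σ τ : PauliString N} {s : Finset (Fin N)}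

theorem exp_smul_of_mul_self_eq_one {n : Type*} [Fintype n] [DecidableEq n]
    {A : Matrix n n ℂ} (hA : A * A = 1) (z : ℂ) :
    NormedSpace.exp (z • A) = Complex.cosh z • 1 + Complex.sinh z • A := by
  rw [NormedSpace.exp_eq_tsum ℂ]
  refine HasSum.tsum_eq (HasSum.even_add_odd ?_ ?_)
  · convert! (Complex.hasSum_cosh z).smul_const (1 : Matrix n n ℂ) using 2 with k
    rw [smul_pow, pow_mul A, sq, hA, one_pow, smul_smul, div_eq_inv_mul]
  · convert! (Complex.hasSum_sinh z).smul_const A using 2 with k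
    rw [smul_pow, pow_succ A, pow_mul A, sq, hA, one_pow, one_mul, smul_smul, div_eq_inv_mul]

theorem rotation_eq (Ω : PauliString N) (t : ℝ) :
    rotation Ω t = (Real.cos t : ℂ) • (1 : Op N) - (Complex.I * (Real.sin t : ℂ)) • Ω.toOp := by
  rw [rotation, exp_smul_of_mul_self_eq_one Ω.toOp_mul_self, Complex.cosh_neg, Complex.sinh_neg,
    mul_comm Complex.I, Complex.cosh_mul_I, Complex.sinh_mul_I, neg_smul, ← sub_eq_add_neg,
    mul_comm Complex.I, Complex.ofReal_cos, Complex.ofReal_sin]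

theorem rotation_zero (Ω : PauliString N) : rotation Ω 0 = 1 := by
  simp [rotation_eq]

theorem rotation_add (Ω : PauliString N) (t t' : ℝ) :
    rotation Ω (t + t') = rotation Ω t * rotation Ω t' := by
  rw [rotation, rotation, rotation, ← Matrix.exp_add_of_commute, ← add_smul]
  · congr 2
    push_cast
    ring
  · exact ((Commute.refl Ω.toOp).smul_left _).smul_right _

theorem conjTranspose_rotation (Ω : PauliString N) (t : ℝ) :
    (rotation Ω t).conjTranspose = rotation Ω (-t) := by
  simp only [rotation_eq, Matrix.conjTranspose_sub, Matrix.conjTranspose_smul,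
    Matrix.conjTranspose_one, PauliString.conjTranspose_toOp, star_mul', Complex.star_def,
    Complex.conj_I, Complex.conj_ofReal, Real.cos_neg, Real.sin_neg, Complex.ofReal_neg, neg_mul,
    mul_neg]

theorem rotation_mem_unitaryGroup (Ω : PauliString N) (t : ℝ) :
    rotation Ω t ∈ Matrix.unitaryGroup (Bits (Fin N)) ℂ := by
  rw [Matrix.mem_unitaryGroup_iff, Matrix.star_eq_conjTranspose, conjTranspose_rotation,
    ← rotation_add, add_neg_cancel, rotation_zero]

theorem continuous_rotation (Ω : PauliString N) : Continuous (rotation Ω) := by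
  simp only [funext (rotation_eq Ω)]
  fun_prop

theorem commute_toOp_rotation (h : σ.commSign Ω = 1) (t : ℝ) :
    Commute σ.toOp (rotation Ω t) := by
  have hΩ : Commute σ.toOp Ω.toOp := by
    rw [commute_iff_eq, PauliString.toOp_mul_comm, h, Int.cast_one, one_smul]
  rw [rotation_eq]
  exact ((Commute.one_right _).smul_right _).sub_right (hΩ.smul_right _)

theorem rotation_mul_toOp (h : σ.commSign Ω = -1) (t : ℝ) :
    rotation Ω (-t) * σ.toOp = σ.toOp * rotation Ω t := by
  simp only [rotation_eq, Real.cos_neg, Real.sin_neg, Complex.ofReal_neg, mul_neg, neg_smul,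
    sub_neg_eq_add, Matrix.add_mul, Matrix.mul_sub, Matrix.smul_mul, Matrix.mul_smul,
    Matrix.one_mul, Matrix.mul_one, PauliString.toOp_mul_eq_neg h, smul_neg]

theorem transfer_rotation (h : σ.commSign Ω = -1) (τ : PauliString N) (t : ℝ) :
    transfer (rotation Ω t) σ τ = Real.cos (2 * t) * (coeff τ σ.toOp).re -
      Real.sin (2 * t) * (Complex.I * coeff τ (σ.toOp * Ω.toOp)).re := by
  have hconj : (rotation Ω t).conjTranspose * σ.toOp * rotation Ω t =
      σ.toOp * rotation Ω (2 * t) := by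
    rw [conjTranspose_rotation, rotation_mul_toOp h, Matrix.mul_assoc, ← rotation_add, two_mul]
  rw [transfer, Matrix.of_apply, hconj, rotation_eq, Matrix.mul_sub, Matrix.mul_smul,
    Matrix.mul_smul, Matrix.mul_one, map_sub, map_smul, map_smul, smul_eq_mul, smul_eq_mul,
    mul_comm Complex.I, mul_assoc, Complex.sub_re, Complex.re_ofReal_mul, Complex.re_ofReal_mul]

/-- The derivative of the transfer matrix of a Pauli rotation. By the parameter-shift rule its row
at a string anticommuting with the generator is twice the row of the shifted rotation. -/
noncomputable def rotDeriv (Ω : PauliString N) (t : ℝ) :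
    Matrix (PauliString N) (PauliString N) ℝ :=
  Matrix.of fun σ τ =>
    if σ.commSign Ω = 1 then 0 else 2 * transfer (rotation Ω (t + Real.pi / 4)) σ τ

theorem rotDeriv_of_commute (h : σ.commSign Ω = 1) (t : ℝ) (τ : PauliString N) :
    rotDeriv Ω t σ τ = 0 := if_pos h

theorem rotDeriv_of_anticommute (h : σ.commSign Ω = -1) (t : ℝ) (τ : PauliString N) :
    rotDeriv Ω t σ τ = 2 * transfer (rotation Ω (t + Real.pi / 4)) σ τ :=
  if_neg (by rw [h]; decide)

theorem hasDerivAt_transfer_rotation (Ω : PauliString N) (t : ℝ) (σ τ : PauliString N) :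
    HasDerivAt (fun t => transfer (rotation Ω t) σ τ) (rotDeriv Ω t σ τ) t := by
  rcases σ.commSign_eq_one_or_neg_one Ω with h | h
  · simp only [rotDeriv_of_commute h, transfer_of_commute_left (rotation_mem_unitaryGroup Ω _)
      (commute_toOp_rotation h _)]
    exact hasDerivAt_const t _
  · simp only [rotDeriv_of_anticommute h, transfer_rotation h]
    have hdouble : HasDerivAt (fun t : ℝ => 2 * t) 2 t := by
      simpa using (hasDerivAt_id t).const_mul 2
    have hshift : 2 * (t + Real.pi / 4) = 2 * t + Real.pi / 2 := by ring
    convert! (hdouble.cos.mul_const _).sub (hdouble.sin.mul_const _) using 1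
    rw [hshift, Real.cos_add_pi_div_two, Real.sin_add_pi_div_two]
    ring

theorem transfer_rotation_eq_zero (hΩ : ∀ q, q ∉ s → Ω q = .I) {q : Fin N} (hq : q ∉ s)
    (h : σ q ≠ τ q) (t : ℝ) : transfer (rotation Ω t) σ τ = 0 := by
  have hrange : rotation Ω t ∈ (embedHom s).range := by
    rw [rotation_eq]
    exact sub_mem (SMulMemClass.smul_mem _ (one_mem _))
      (SMulMemClass.smul_mem _ (toOp_mem_range_embedHom hΩ))
  obtain ⟨u, hu⟩ := exists_localUnitary (rotation_mem_unitaryGroup Ω t) hrange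
  rw [← hu, transfer_embed_eq_zero u hq h]

theorem rotDeriv_eq_zero (hΩ : ∀ q, q ∉ s → Ω q = .I) {q : Fin N} (hq : q ∉ s)
    (h : σ q ≠ τ q) (t : ℝ) : rotDeriv Ω t σ τ = 0 := by
  rw [rotDeriv, Matrix.of_apply, transfer_rotation_eq_zero hΩ hq h, mul_zero, ite_self]

theorem commSign_eq_neg_one_of_rotDeriv_ne_zero {t : ℝ} (h : rotDeriv Ω t σ τ ≠ 0) :
    τ.commSign Ω = -1 := by
  refine (τ.commSign_eq_one_or_neg_one Ω).resolve_left fun hτ => h ?_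
  rcases σ.commSign_eq_one_or_neg_one Ω with hσ | hσ
  · exact rotDeriv_of_commute hσ t τ
  · have hne : σ ≠ τ := by rintro rfl; omega
    rw [rotDeriv_of_anticommute hσ, transfer_of_commute_right (rotation_mem_unitaryGroup Ω _) σ
      (commute_toOp_rotation hτ _), if_neg hne, mul_zero]

theorem sum_rotDeriv_sq (h : σ.commSign Ω = -1) (t : ℝ) : ∑ τ, rotDeriv Ω t σ τ ^ 2 = 4 := by
  simp only [rotDeriv_of_anticommute h, mul_pow, ← Finset.mul_sum,
    sum_transfer_sq (rotation_mem_unitaryGroup Ω _)]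
  norm_num

theorem abs_rotDeriv_le (Ω : PauliString N) (t : ℝ) (σ τ : PauliString N) :
    |rotDeriv Ω t σ τ| ≤ 2 := by
  rcases σ.commSign_eq_one_or_neg_one Ω with h | h
  · simp [rotDeriv_of_commute h]
  · rw [rotDeriv_of_anticommute h, abs_mul, abs_two]
    linarith [abs_transfer_le_one (rotation_mem_unitaryGroup Ω (t + Real.pi / 4)) σ τ]

theorem measurable_rotDeriv (Ω σ τ : PauliString N) : Measurable fun t => rotDeriv Ω t σ τ := by
  have hcont : Continuous fun t => transfer (rotation Ω (t + Real.pi / 4)) σ τ :=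
    (continuous_transfer σ τ).comp ((continuous_rotation Ω).comp (continuous_add_const _))
  exact Measurable.ite (MeasurableSet.const _) measurable_const (hcont.measurable.const_mul 2)

theorem PauliString.eq_I_of_notMem (hs : Ω.supp ⊆ s) (q : Fin N) (hq : q ∉ s) : Ω q = .I := by
  by_contra h
  exact hq (hs (PauliString.mem_supp.2 h))

theorem commSign_eq_one_of_trivial (hs : Ω.supp ⊆ s) {σ : PauliString N}
    (hσ : ∀ q ∈ s, σ q = .I) : σ.commSign Ω = 1 :=
  Finset.prod_eq_one fun q _ => by
    by_cases hq : q ∈ s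
    · rw [hσ q hq, Pauli.commSign_I_left]
    · rw [PauliString.eq_I_of_notMem hs q hq, Pauli.commSign_I_right]

theorem two_mul_card_anticommuting (hΩ : Ω.supp.Nonempty) (hs : Ω.supp ⊆ s)
    (σ : PauliString N) :
    2 * ((nontrivialClass s σ).filter fun τ => τ.commSign Ω = -1).card = 4 ^ s.card := by
  obtain ⟨q, hq⟩ := hΩ
  have hfilter : (nontrivialClass s σ).filter (fun τ => τ.commSign Ω = -1) =
      (agreeOff s σ).filter fun τ => τ.commSign Ω = -1 := by
    rw [nontrivialClass, Finset.filter_filter]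
    refine Finset.filter_congr fun τ _ => and_iff_right_of_imp fun h => ?_
    by_contra! htriv
    have := commSign_eq_one_of_trivial hs htriv
    omega
  rw [hfilter]
  exact two_mul_card_filter_commSign_eq_neg_one ⟨q, hs hq, PauliString.mem_supp.1 hq⟩ σ

end Rotation

/-! ### Products of independent random matrices -/

section RandomMatrix

/-- The product of the matrices indexed by a list, applied to a vector; the last matrix of the
list acts first. -/
def mulVecChain {X ι ι' : Type*} [Fintype ι] (T : ι' → X → Matrix ι ι ℝ) (z : ι → ℝ) :
    List ι' → X → ι → ℝ
  | [] => fun _ => z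
  | i :: l => fun x => (T i x).mulVec (mulVecChain T z l x)

theorem measurable_mulVec {X ι : Type*} [Fintype ι] {_ : MeasurableSpace X}
    {T : X → Matrix ι ι ℝ} {V : X → ι → ℝ} (hT : ∀ i j, Measurable fun x => T x i j)
    (hV : Measurable V) : Measurable fun x => (T x).mulVec (V x) :=
  measurable_pi_lambda _ fun i => Finset.measurable_sum _ fun j _ =>
    (hT i j).mul ((measurable_pi_apply j).comp hV)

theorem measurable_mulVecChain {X ι ι' : Type*} [Fintype ι] {mι : ι' → MeasurableSpace X}
    {T : ι' → X → Matrix ι ι ℝ} (hT : ∀ i j k, Measurable[mι i] fun x => T i x j k)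
    (z : ι → ℝ) (l : List ι') : Measurable[⨆ i ∈ {i | i ∈ l}, mι i] (mulVecChain T z l) := by
  induction l with
  | nil => exact measurable_const
  | cons i l ih =>
    have hhead : mι i ≤ ⨆ i' ∈ {i' | i' ∈ i :: l}, mι i' := le_biSup mι List.mem_cons_self
    have htail : ⨆ i' ∈ {i' | i' ∈ l}, mι i' ≤ ⨆ i' ∈ {i' | i' ∈ i :: l}, mι i' :=
      biSup_mono fun _ hj => List.mem_cons_of_mem _ hj
    exact measurable_mulVec (fun j k => (hT i j k).mono hhead le_rfl) (ih.mono htail le_rfl)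

variable {X : Type*} [MeasurableSpace X] {π : Measure X} {ι κ κ' : Type*}

/-- A random vector with measurable and uniformly bounded entries. -/
structure IsBoundedRandom (V : X → κ → ℝ) : Prop where
  measurable : Measurable V
  bounded : ∃ C, ∀ x i, |V x i| ≤ C

namespace IsBoundedRandom

variable {V : X → κ → ℝ} {W : X → κ' → ℝ}

theorem measurable_apply (hV : IsBoundedRandom V) (i : κ) : Measurable fun x => V x i :=
  (measurable_pi_apply i).comp hV.measurable

theorem memLp [IsFiniteMeasure π] (hV : IsBoundedRandom V) (i : κ) (p : ENNReal) :
    MemLp (fun x => V x i) p π := by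
  obtain ⟨C, hC⟩ := hV.bounded
  exact MemLp.of_bound (hV.measurable_apply i).aestronglyMeasurable C
    (Filter.Eventually.of_forall fun x => hC x i)

theorem integrable_mul [IsFiniteMeasure π] (hV : IsBoundedRandom V) (hW : IsBoundedRandom W)
    (i : κ) (j : κ') : Integrable (fun x => V x i * W x j) π :=
  (hV.memLp i 2).integrable_mul (hW.memLp j 2)

theorem mulVec [Fintype ι] {T : X → Matrix ι ι ℝ} {V : X → ι → ℝ}
    (hT : IsBoundedRandom fun x (p : ι × ι) => T x p.1 p.2) (hV : IsBoundedRandom V) :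
    IsBoundedRandom fun x => (T x).mulVec (V x) where
  measurable := measurable_mulVec (fun i j => hT.measurable_apply (i, j)) hV.measurable
  bounded := by
    obtain ⟨C, hC⟩ := hT.bounded
    obtain ⟨D, hD⟩ := hV.bounded
    refine ⟨∑ _j : ι, C * D, fun x i => ?_⟩
    refine (Finset.abs_sum_le_sum_abs _ _).trans (Finset.sum_le_sum fun j _ => ?_)
    rw [abs_mul]
    exact mul_le_mul (hC x (i, j)) (hD x j) (abs_nonneg _) ((abs_nonneg _).trans (hC x (i, j)))

theorem mulVecChain [Fintype ι] {ι' : Type*} {T : ι' → X → Matrix ι ι ℝ}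
    (hT : ∀ i, IsBoundedRandom fun x (p : ι × ι) => T i x p.1 p.2) (z : ι → ℝ) (l : List ι') :
    IsBoundedRandom (mulVecChain T z l) := by
  induction l with
  | nil =>
    refine ⟨measurable_const, ∑ j, |z j|, fun _ i => ?_⟩
    exact Finset.single_le_sum (f := fun j => |z j|) (fun _ _ => abs_nonneg _) (Finset.mem_univ i)
  | cons i l ih => exact (hT i).mulVec ih

end IsBoundedRandom

/-- A random matrix and a random vector, independent, measurable and bounded. -/
structure IndepApply (π : Measure X) (T : X → Matrix ι ι ℝ) (V : X → ι → ℝ) : Prop where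
  mat : IsBoundedRandom fun x (p : ι × ι) => T x p.1 p.2
  vec : IsBoundedRandom V
  indep : IndepFun (fun x (p : ι × ι) => T x p.1 p.2) V π

variable [Fintype ι] {T : X → Matrix ι ι ℝ} {V : X → ι → ℝ}

theorem IndepApply.integral_mulVec [IsProbabilityMeasure π] (h : IndepApply π T V) (i : ι) :
    ∫ x, (T x).mulVec (V x) i ∂π = ∑ j, (∫ x, T x i j ∂π) * ∫ x, V x j ∂π := by
  have hindep (j : ι) : IndepFun (fun x => T x i j) (fun x => V x j) π :=
    h.indep.comp (measurable_pi_apply (i, j)) (measurable_pi_apply j)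
  simp only [Matrix.mulVec, dotProduct]
  rw [integral_finsetSum _ fun j _ => h.mat.integrable_mul h.vec (i, j) j]
  exact Finset.sum_congr rfl fun j _ => (hindep j).integral_fun_mul_eq_mul_integral
    (h.mat.measurable_apply (i, j)).aestronglyMeasurable
    (h.vec.measurable_apply j).aestronglyMeasurable

theorem IndepApply.integral_mulVec_mul_mulVec [IsProbabilityMeasure π] (h : IndepApply π T V)
    (i i' : ι) : ∫ x, (T x).mulVec (V x) i * (T x).mulVec (V x) i' ∂π =
      ∑ j, ∑ j', (∫ x, T x i j * T x i' j' ∂π) * ∫ x, V x j * V x j' ∂π := by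
  have hindep (j j' : ι) :
      IndepFun (fun x => T x i j * T x i' j') (fun x => V x j * V x j') π :=
    h.indep.comp (φ := fun f : ι × ι → ℝ => f (i, j) * f (i', j'))
      (ψ := fun g : ι → ℝ => g j * g j') (by fun_prop) (by fun_prop)
  have hmat (j j' : ι) : Integrable (fun x => T x i j * T x i' j') π :=
    h.mat.integrable_mul h.mat (i, j) (i', j')
  have hvec (j j' : ι) : Integrable (fun x => V x j * V x j') π := h.vec.integrable_mul h.vec j j'
  have hexpand (x : X) : (T x).mulVec (V x) i * (T x).mulVec (V x) i' =
      ∑ j, ∑ j', T x i j * T x i' j' * (V x j * V x j') := by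
    simp only [Matrix.mulVec, dotProduct, Finset.sum_mul_sum, mul_mul_mul_comm]
  have hint (j j' : ι) : Integrable (fun x => T x i j * T x i' j' * (V x j * V x j')) π :=
    (hindep j j').integrable_mul (hmat j j') (hvec j j')
  simp only [hexpand]
  rw [integral_finsetSum _ fun j _ => integrable_finsetSum _ fun j' _ => hint j j']
  refine Finset.sum_congr rfl fun j _ => ?_
  rw [integral_finsetSum _ fun j' _ => hint j j']
  exact Finset.sum_congr rfl fun j' _ => (hindep j j').integral_fun_mul_eq_mul_integral
    (hmat j j').aestronglyMeasurable (hvec j j').aestronglyMeasurable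

theorem indepApply_mulVecChain {ι' : Type*} {mι : ι' → MeasurableSpace X}
    (hle : ∀ i, mι i ≤ ‹MeasurableSpace X›) (hindep : iIndep mι π) {T : ι' → X → Matrix ι ι ℝ}
    (hm : ∀ i j k, Measurable[mι i] fun x => T i x j k)
    (hT : ∀ i, IsBoundedRandom fun x (p : ι × ι) => T i x p.1 p.2) (z : ι → ℝ)
    {i : ι'} {l : List ι'} (hi : i ∉ l) : IndepApply π (T i) (mulVecChain T z l) := by
  refine ⟨hT i, .mulVecChain hT z l, ?_⟩
  have hdisj : Indep (⨆ i' ∈ ({i} : Set ι'), mι i') (⨆ i' ∈ {i' | i' ∈ l}, mι i') π :=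
    indep_iSup_of_disjoint hle hindep (by simpa using hi)
  have hmat : Measurable[mι i] fun x (p : ι × ι) => T i x p.1 p.2 :=
    @measurable_pi_lambda X (ι × ι) _ (mι i) _ _ fun p => hm i p.1 p.2
  rw [IndepFun_iff_Indep]
  exact indep_of_indep_of_le_left (indep_of_indep_of_le_right hdisj
    (measurable_mulVecChain hm z l).comap_le) (by simpa using hmat.comap_le)

theorem variance_sum_of_orthogonal [IsProbabilityMeasure π] {J : Type*} [Fintype J]
    {Y : J → X → ℝ} (hY : ∀ j, MemLp (Y j) 2 π) (hmean : ∀ j, ∫ x, Y j x ∂π = 0)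
    (horth : ∀ j j', j ≠ j' → ∫ x, Y j x * Y j' x ∂π = 0) (lam : J → ℝ) :
    Var[fun x => ∑ j, lam j * Y j x; π] = ∑ j, lam j ^ 2 * ∫ x, Y j x ^ 2 ∂π := by
  have hcov (j j' : J) : cov[fun x => lam j * Y j x, fun x => lam j' * Y j' x; π] =
      lam j * (lam j' * ∫ x, Y j x * Y j' x ∂π) := by
    rw [covariance_const_mul_left, covariance_const_mul_right, covariance_eq_sub (hY j) (hY j'),
      hmean, zero_mul, sub_zero]
    rfl
  rw [variance_fun_sum fun j => (hY j).const_mul (lam j)]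
  refine Finset.sum_congr rfl fun j _ => ?_
  rw [Finset.sum_eq_single_of_mem j (Finset.mem_univ j) fun j' _ hne => by
    rw [hcov, horth j j' hne.symm, mul_zero, mul_zero], hcov, ← mul_assoc, sq]
  simp only [sq]

end RandomMatrix

/-! ### Layers acting on random vectors of Pauli components -/

section Layers

variable {N : ℕ} {X : Type*} [MeasurableSpace X] {π : Measure X}
  {V : X → PauliString N → ℝ} {s S S' : Finset (Fin N)}

/-- The components of the random vector `V` along any two strings which differ on a qubit of `S`
are uncorrelated (their second mixed moment vanishes). -/
def UncorrelatedOn (π : Measure X) (V : X → PauliString N → ℝ) (S : Finset (Fin N)) : Prop :=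
  ∀ σ σ' : PauliString N, ∀ q ∈ S, σ q ≠ σ' q → ∫ x, V x σ * V x σ' ∂π = 0

theorem UncorrelatedOn.mono (h : UncorrelatedOn π V S) (hS : S' ⊆ S) : UncorrelatedOn π V S' :=
  fun σ σ' q hq => h σ σ' q (hS hq)

theorem uncorrelatedOn_mulVec [IsProbabilityMeasure π]
    {T : X → Matrix (PauliString N) (PauliString N) ℝ}
    (h : IndepApply π T V) (hV : UncorrelatedOn π V S)
    (hlocal : ∀ x, ∀ q ∈ S, q ∉ S' → ∀ σ τ : PauliString N, σ q ≠ τ q → T x σ τ = 0)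
    (huncorr : ∀ q ∈ S', ∀ σ σ' : PauliString N, σ q ≠ σ' q →
      ∀ τ τ', ∫ x, T x σ τ * T x σ' τ' ∂π = 0) :
    UncorrelatedOn π (fun x => (T x).mulVec (V x)) (S ∪ S') := by
  intro σ σ' q hq hne
  rw [h.integral_mulVec_mul_mulVec]
  refine Finset.sum_eq_zero fun τ _ => Finset.sum_eq_zero fun τ' _ => ?_
  by_cases hqS' : q ∈ S'
  · rw [huncorr q hqS' σ σ' hne, zero_mul]
  have hqS : q ∈ S := (Finset.mem_union.1 hq).resolve_right hqS'
  by_cases hστ : σ q = τ q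
  · by_cases hστ' : σ' q = τ' q
    · rw [hV τ τ' q hqS (by rwa [← hστ, ← hστ']), mul_zero]
    · simp [fun x => hlocal x q hqS hqS' σ' τ' hστ']
  · simp [fun x => hlocal x q hqS hqS' σ τ hστ]

/-- Conjugation of an operator with random Pauli components `V` by the random unitary `u`. -/
noncomputable def actUnitary (u : X → LocalUnitary s) (V : X → PauliString N → ℝ) :
    X → PauliString N → ℝ :=
  fun x => (transfer (embed s (u x).1)).mulVec (V x)

theorem actUnitary_of_trivial {X : Type*} (u : X → LocalUnitary s) (V : X → PauliString N → ℝ)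
    {σ : PauliString N} (hσ : ∀ q ∈ s, σ q = .I) (x : X) : actUnitary u V x σ = V x σ := by
  simp [actUnitary, Matrix.mulVec, dotProduct, transfer_embed_of_trivial_left (u x) hσ]

/-- The random unitary `u` forms a `2`-design independent of the random vector `V`. -/
structure IsDesignLayer (π : Measure X) (u : X → LocalUnitary s) (V : X → PauliString N → ℝ) :
    Prop where
  measurable : Measurable u
  design : IsUnitaryDesign 2 (π.map u)
  indep : IndepApply π (fun x => transfer (embed s (u x).1)) V

namespace IsDesignLayer

variable [IsProbabilityMeasure π] {u : X → LocalUnitary s} {σ : PauliString N}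

theorem uncorrelatedOn (h : IsDesignLayer π u V) (hV : UncorrelatedOn π V S) :
    UncorrelatedOn π (actUnitary u V) (S ∪ s) :=
  uncorrelatedOn_mulVec h.indep hV
    (fun x _ _ hq _ _ hne => transfer_embed_eq_zero (u x) hq hne)
    (fun _ hq _ _ hne => integral_transfer_mul_of_left_ne h.measurable h.design hq hne)

theorem integral_sq_of_nontrivial (h : IsDesignLayer π u V) (hσ : ∃ q ∈ s, σ q ≠ .I) :
    ∫ x, actUnitary u V x σ ^ 2 ∂π =
      ((4 : ℝ) ^ s.card - 1)⁻¹ * ∑ τ ∈ nontrivialClass s σ, ∫ x, V x τ ^ 2 ∂π := by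
  simp only [sq, actUnitary]
  rw [h.indep.integral_mulVec_mul_mulVec]
  simp only [integral_transfer_mul_of_nontrivial h.measurable h.design hσ, ite_and, ite_mul,
    zero_mul, Finset.sum_ite_eq, Finset.mem_univ, if_true]
  rw [← Finset.sum_filter, Finset.filter_mem_eq_inter, Finset.univ_inter, Finset.mul_sum]

theorem integral_eq_zero (h : IsDesignLayer π u V) (hV : ∀ τ, ∫ x, V x τ ∂π = 0)
    (σ : PauliString N) : ∫ x, actUnitary u V x σ ∂π = 0 := by
  simp only [actUnitary]
  rw [h.indep.integral_mulVec]
  simp only [hV, mul_zero, Finset.sum_const_zero]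

theorem integral_eq_zero_of_trivial (h : IsDesignLayer π u V)
    (hV : ∀ τ : PauliString N, (∀ q ∈ s, τ q = .I) → ∫ x, V x τ ∂π = 0) (σ : PauliString N) :
    ∫ x, actUnitary u V x σ ∂π = 0 := by
  by_cases hσ : ∃ q ∈ s, σ q ≠ .I
  · simp only [actUnitary]
    rw [h.indep.integral_mulVec]
    simp only [integral_transfer_of_nontrivial h.measurable h.design hσ, zero_mul,
      Finset.sum_const_zero]
  · push Not at hσ
    simp only [actUnitary_of_trivial u V hσ, hV σ hσ]

end IsDesignLayer

variable {Ω : PauliString N} {t : X → ℝ}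

/-- The derivative of the conjugation by a Pauli rotation of random angle `t`, applied to an
operator with random Pauli components `V`. -/
noncomputable def actRotDeriv (Ω : PauliString N) (t : X → ℝ) (V : X → PauliString N → ℝ) :
    X → PauliString N → ℝ :=
  fun x => (rotDeriv Ω (t x)).mulVec (V x)

theorem rotDeriv_mem_nontrivialClass (hs : Ω.supp ⊆ s) {σ τ : PauliString N} {r : ℝ}
    (h : rotDeriv Ω r σ τ ≠ 0) : τ ∈ nontrivialClass s σ := by
  rw [mem_nontrivialClass]
  refine ⟨fun q hq => ?_, ?_⟩
  · by_contra hne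
    exact h (rotDeriv_eq_zero (PauliString.eq_I_of_notMem hs) hq (Ne.symm hne) r)
  · by_contra! htriv
    have := commSign_eq_one_of_trivial hs htriv
    have := commSign_eq_neg_one_of_rotDeriv_ne_zero h
    omega

theorem integral_actRotDeriv_sq [IsProbabilityMeasure π] (hs : Ω.supp ⊆ s)
    (h : IndepApply π (fun x => rotDeriv Ω (t x)) V) (hV : UncorrelatedOn π V s)
    {σ : PauliString N} (hσ : σ.commSign Ω = -1) {g : ℝ}
    (hg : ∀ τ ∈ nontrivialClass s σ, ∫ x, V x τ ^ 2 ∂π = g) :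
    ∫ x, actRotDeriv Ω t V x σ ^ 2 ∂π = 4 * g := by
  have hzero {τ : PauliString N} (hτ : τ ∉ nontrivialClass s σ) (x : X) :
      rotDeriv Ω (t x) σ τ = 0 := by
    by_contra hne
    exact hτ (rotDeriv_mem_nontrivialClass hs hne)
  have hoff (τ τ' : PauliString N) (hne : τ' ≠ τ) :
      (∫ x, rotDeriv Ω (t x) σ τ * rotDeriv Ω (t x) σ τ' ∂π) * ∫ x, V x τ * V x τ' ∂π = 0 := by
    by_cases hτ : τ ∈ nontrivialClass s σ
    swap
    · simp [hzero hτ]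
    by_cases hτ' : τ' ∈ nontrivialClass s σ
    swap
    · simp [hzero hτ']
    obtain ⟨q, hq⟩ := Function.ne_iff.1 hne
    rw [mem_nontrivialClass] at hτ hτ'
    have hqs : q ∈ s := by
      by_contra hqs
      exact hq ((hτ'.1 q hqs).trans (hτ.1 q hqs).symm)
    rw [hV τ τ' q hqs (Ne.symm hq), mul_zero]
  have hdiag (τ : PauliString N) :
      (∫ x, rotDeriv Ω (t x) σ τ * rotDeriv Ω (t x) σ τ ∂π) * ∫ x, V x τ * V x τ ∂π =
        (∫ x, rotDeriv Ω (t x) σ τ ^ 2 ∂π) * g := by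
    simp only [← sq]
    by_cases hτ : τ ∈ nontrivialClass s σ
    · rw [hg τ hτ]
    · simp [hzero hτ]
  have hint (τ : PauliString N) : Integrable (fun x => rotDeriv Ω (t x) σ τ ^ 2) π := by
    simpa only [sq] using h.mat.integrable_mul h.mat (σ, τ) (σ, τ)
  calc ∫ x, actRotDeriv Ω t V x σ ^ 2 ∂π
      = ∑ τ, ∑ τ', (∫ x, rotDeriv Ω (t x) σ τ * rotDeriv Ω (t x) σ τ' ∂π) *
          ∫ x, V x τ * V x τ' ∂π := by
        simp only [sq]
        exact h.integral_mulVec_mul_mulVec σ σ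
    _ = ∑ τ, (∫ x, rotDeriv Ω (t x) σ τ ^ 2 ∂π) * g :=
        Finset.sum_congr rfl fun τ _ => (Fintype.sum_eq_single τ (hoff τ)).trans (hdiag τ)
    _ = 4 * g := by
        rw [← Finset.sum_mul, ← integral_finsetSum _ fun τ _ => hint τ]
        simp [sum_rotDeriv_sq hσ]

end Layers

/-! ### The block which contains the differentiated gate -/

section Sandwich

variable {N : ℕ} {X : Type*} [MeasurableSpace X] {π : Measure X} {V : X → PauliString N → ℝ}
  {s : Finset (Fin N)} {Ω : PauliString N} {t : X → ℝ} {L R : X → LocalUnitary s}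

/-- A Pauli rotation of random angle `t` with non-identity generator `Ω` supported on `s`, between
the random unitaries `L` (acting before it) and `R` (acting after it) which form `2`-designs on `s`;
each of the three is independent of everything it acts on. -/
structure IsDesignSandwich (π : Measure X) (Ω : PauliString N) (t : X → ℝ)
    (L R : X → LocalUnitary s) (V : X → PauliString N → ℝ) : Prop where
  nonempty : Ω.supp.Nonempty
  supp_subset : Ω.supp ⊆ s
  left : IsDesignLayer π L V
  gate : IndepApply π (fun x => rotDeriv Ω (t x)) (actUnitary L V)
  right : IsDesignLayer π R (actRotDeriv Ω t (actUnitary L V))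

namespace IsDesignSandwich

variable [IsProbabilityMeasure π] {S : Finset (Fin N)}

theorem uncorrelatedOn (h : IsDesignSandwich π Ω t L R V) (hV : UncorrelatedOn π V S) :
    UncorrelatedOn π (actUnitary R (actRotDeriv Ω t (actUnitary L V))) (S ∪ s) := by
  have hL : UncorrelatedOn π (actUnitary L V) (S \ s) :=
    (h.left.uncorrelatedOn hV).mono (Finset.sdiff_subset.trans Finset.subset_union_left)
  have hD : UncorrelatedOn π (actRotDeriv Ω t (actUnitary L V)) (S \ s ∪ ∅) :=
    uncorrelatedOn_mulVec h.gate hL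
      (fun x q hq _ σ τ hne => rotDeriv_eq_zero (PauliString.eq_I_of_notMem h.supp_subset)
        (Finset.mem_sdiff.1 hq).2 hne (t x)) (by simp)
  exact (h.right.uncorrelatedOn hD).mono (by simp)

theorem le_sum_integral_actRotDeriv_sq (h : IsDesignSandwich π Ω t L R V)
    (hV : UncorrelatedOn π V S) (σ : PauliString N) :
    2 * 4 ^ s.card *
        (((4 : ℝ) ^ s.card - 1)⁻¹ * ∑ τ ∈ nontrivialClass s σ, ∫ x, V x τ ^ 2 ∂π) ≤
      ∑ α ∈ nontrivialClass s σ, ∫ x, actRotDeriv Ω t (actUnitary L V) x α ^ 2 ∂π := by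
  set g := ((4 : ℝ) ^ s.card - 1)⁻¹ * ∑ τ ∈ nontrivialClass s σ, ∫ x, V x τ ^ 2 ∂π
  set A := (nontrivialClass s σ).filter fun α => α.commSign Ω = -1 with hA
  have huniform : ∀ τ ∈ nontrivialClass s σ, ∫ x, actUnitary L V x τ ^ 2 ∂π = g := by
    intro τ hτ
    rw [mem_nontrivialClass] at hτ
    rw [h.left.integral_sq_of_nontrivial hτ.2, nontrivialClass_congr hτ.1]
  have hactive : ∀ α ∈ A, ∫ x, actRotDeriv Ω t (actUnitary L V) x α ^ 2 ∂π = 4 * g := by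
    intro α hα
    rw [hA, Finset.mem_filter, mem_nontrivialClass] at hα
    refine integral_actRotDeriv_sq h.supp_subset h.gate
      ((h.left.uncorrelatedOn hV).mono Finset.subset_union_right) hα.2 fun τ hτ => huniform τ ?_
    rwa [nontrivialClass_congr hα.1.1] at hτ
  have hcard : (2 : ℝ) * A.card = 4 ^ s.card := by
    exact_mod_cast two_mul_card_anticommuting h.nonempty h.supp_subset σ
  calc 2 * 4 ^ s.card * g
      = ∑ _α ∈ A, 4 * g := by
        rw [Finset.sum_const, nsmul_eq_mul, ← hcard]
        ring
    _ = ∑ α ∈ A, ∫ x, actRotDeriv Ω t (actUnitary L V) x α ^ 2 ∂π :=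
        (Finset.sum_congr rfl hactive).symm
    _ ≤ _ := Finset.sum_le_sum_of_subset_of_nonneg (Finset.filter_subset _ _)
        fun _ _ _ => integral_nonneg fun _ => sq_nonneg _

theorem le_integral_sq (h : IsDesignSandwich π Ω t L R V) (hV : UncorrelatedOn π V S)
    {σ : PauliString N} (hσ : ∃ q ∈ s, σ q ≠ .I) :
    2 * (((4 : ℝ) ^ s.card - 1)⁻¹ * ∑ τ ∈ nontrivialClass s σ, ∫ x, V x τ ^ 2 ∂π) ≤
      ∫ x, actUnitary R (actRotDeriv Ω t (actUnitary L V)) x σ ^ 2 ∂π := by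
  have hsum := h.le_sum_integral_actRotDeriv_sq hV σ
  set g := ((4 : ℝ) ^ s.card - 1)⁻¹ * ∑ τ ∈ nontrivialClass s σ, ∫ x, V x τ ^ 2 ∂π
  have hone : (1 : ℝ) < 4 ^ s.card :=
    one_lt_pow₀ (by norm_num) (Finset.card_pos.2 (h.nonempty.mono h.supp_subset)).ne'
  have hg0 : 0 ≤ g := mul_nonneg (inv_nonneg.2 (sub_pos.2 hone).le)
    (Finset.sum_nonneg fun _ _ => integral_nonneg fun _ => sq_nonneg _)
  rw [h.right.integral_sq_of_nontrivial hσ, inv_mul_eq_div, le_div_iff₀ (sub_pos.2 hone)]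
  refine le_trans ?_ hsum
  linarith

theorem integral_eq_zero (h : IsDesignSandwich π Ω t L R V) (σ : PauliString N) :
    ∫ x, actUnitary R (actRotDeriv Ω t (actUnitary L V)) x σ ∂π = 0 := by
  refine h.right.integral_eq_zero_of_trivial (fun τ hτ => ?_) σ
  have hτΩ := commSign_eq_one_of_trivial h.supp_subset hτ
  simp [actRotDeriv, Matrix.mulVec, dotProduct, rotDeriv_of_commute hτΩ]

end IsDesignSandwich

end Sandwich

/-! ### The Pauli expansion of the cost -/

section InitialState

variable {N : ℕ}

/-- The Pauli components `⟨0|τ|0⟩` of the initial state. -/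
def initialVec (τ : PauliString N) : ℝ := if ∀ q, τ q = .I ∨ τ q = .Z then 1 else 0

theorem toOp_zero_zero (τ : PauliString N) : τ.toOp 0 0 = (initialVec τ : ℂ) := by
  have hprod : τ.toOp 0 0 = ∏ q, (τ q).toMatrix 0 0 := rfl
  rw [hprod, initialVec]
  split_ifs with h
  · rw [Complex.ofReal_one]
    refine Finset.prod_eq_one fun q _ => ?_
    rcases h q with h | h <;> simp [h, Pauli.toMatrix]
  · push Not at h
    obtain ⟨q, hI, hZ⟩ := h
    rw [Complex.ofReal_zero]
    refine Finset.prod_eq_zero (Finset.mem_univ q) ?_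
    revert hI hZ
    cases τ q <;> simp [Pauli.toMatrix]

theorem trace_single_mul_conj (U : Op N) (σ : PauliString N) :
    (Matrix.single 0 0 1 * (U.conjTranspose * σ.toOp * U)).trace =
      (((transfer U).mulVec initialVec σ : ℝ) : ℂ) := by
  rw [← sum_transfer_smul, Finset.mul_sum, Matrix.trace_sum, Matrix.mulVec, dotProduct,
    Complex.ofReal_sum]
  refine Finset.sum_congr rfl fun τ _ => ?_
  rw [Matrix.mul_smul, Matrix.trace_smul, Matrix.trace_single_mul, smul_eq_mul,
    toOp_zero_zero, one_smul, Complex.ofReal_mul]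

theorem Circuit.cost_eq_sum {m M : ℕ} (c : Circuit N m M) {J : Type} [Fintype J] (lam : J → ℝ)
    (h : J → PauliString N) (θ : Fin M → ℝ) :
    c.cost (∑ j, (lam j : ℂ) • (h j).toOp) θ =
      ∑ j, lam j * (transfer (c.unitary θ)).mulVec initialVec (h j) := by
  rw [Circuit.cost, Matrix.mul_assoc, Matrix.mul_assoc, ← Matrix.mul_assoc _ _ (c.unitary θ),
    Finset.mul_sum, Finset.sum_mul, Finset.mul_sum, Matrix.trace_sum, Complex.re_sum]
  refine Finset.sum_congr rfl fun j _ => ?_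
  rw [Matrix.mul_smul, Matrix.smul_mul, Matrix.mul_smul, Matrix.trace_smul,
    trace_single_mul_conj, smul_eq_mul, ← Complex.ofReal_mul, Complex.ofReal_re]

end InitialState

/-! ### The derivative of the cost as a product of random matrices -/

section CircuitLayers

/-- The layers of a circuit: the blocks other than `kμ` and, numbered by `Fin 3`, the sub-blocks
`L`, `R` of the block `kμ` and the gate between them. -/
abbrev Layer {m : ℕ} (kμ : Fin m) : Type := {k : Fin m // k ≠ kμ} ⊕ Fin 3

/-- The layers of the block `k`, the last one first. -/
def blockLayers {m : ℕ} (kμ k : Fin m) : List (Layer kμ) :=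
  if h : k = kμ then [.inr 1, .inr 2, .inr 0] else [.inl ⟨k, h⟩]

variable {N m M : ℕ} {c : Circuit N m M} {kμ : Fin m} {L R : (Fin M → ℝ) → LocalUnitary (c.s kμ)}
  {K : (Fin M → ℝ) → Matrix (PauliString N) (PauliString N) ℝ} {l : List (Fin m)} {k : Fin m}

theorem mem_of_mem_flatMap_blockLayers {i : Layer kμ} (hi : i ∈ l.flatMap (blockLayers kμ)) :
    Sum.elim Subtype.val (fun _ => kμ) i ∈ l := by
  obtain ⟨k, hk, hik⟩ := List.mem_flatMap.1 hi
  suffices Sum.elim Subtype.val (fun _ => kμ) i = k from this ▸ hk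
  rw [blockLayers] at hik
  split_ifs at hik with h
  · simp only [List.mem_cons, List.not_mem_nil, or_false] at hik
    rcases hik with rfl | rfl | rfl <;> exact h.symm
  · rw [List.mem_singleton.1 hik]
    rfl

variable (c L R K) in
/-- The matrices by which the layers act on Pauli components; the matrix `K` of the gate between
`L` and `R` is a parameter, since the gate is to be replaced by its derivative. -/
noncomputable def layerMat : Layer kμ → (Fin M → ℝ) → Matrix (PauliString N) (PauliString N) ℝ
  | .inl k => fun θ => transfer (embed (c.s k) (c.block k θ).1)
  | .inr i => ![fun θ => transfer (embed (c.s kμ) (L θ).1),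
      fun θ => transfer (embed (c.s kμ) (R θ).1), K] i

variable (c L R K) in
/-- The vector with entries `⟨0|U†σU|0⟩`, where `U` is composed of the blocks in the list `l`, the
last one first, and the gate in the block `kμ` acts by the matrix `K`. -/
noncomputable def pauliVec (l : List (Fin m)) : (Fin M → ℝ) → PauliString N → ℝ :=
  mulVecChain (layerMat c L R K) initialVec (l.flatMap (blockLayers kμ))

theorem pauliVec_cons_of_ne (hk : k ≠ kμ) :
    pauliVec c L R K (k :: l) = actUnitary (c.block k) (pauliVec c L R K l) := by
  rw [pauliVec, List.flatMap_cons, blockLayers, dif_neg hk]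
  rfl

theorem pauliVec_cons_self : pauliVec c L R K (kμ :: l) =
    actUnitary R fun θ => (K θ).mulVec (actUnitary L (pauliVec c L R K l) θ) := by
  rw [pauliVec, List.flatMap_cons, blockLayers, dif_pos rfl]
  rfl

variable {π : Measure (Fin M → ℝ)} {Ω : PauliString N} {μ : Fin M}

theorem transfer_prod_mulVec_initialVec (hblock : ∀ θ, embed (c.s kμ) (c.block kμ θ).1 =
      embed (c.s kμ) (R θ).1 * rotation Ω (θ μ) * embed (c.s kμ) (L θ).1)
    (l : List (Fin m)) (θ : Fin M → ℝ) :
    (transfer (l.map fun k => embed (c.s k) (c.block k θ).1).prod).mulVec initialVec =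
      pauliVec c L R (fun θ => transfer (rotation Ω (θ μ))) l θ := by
  induction l with
  | nil => simp [pauliVec, mulVecChain, transfer_one]
  | cons k l ih =>
    rw [List.map_cons, List.prod_cons, transfer_mul, ← Matrix.mulVec_mulVec, ih]
    by_cases hk : k = kμ
    · subst hk
      rw [pauliVec_cons_self, hblock, transfer_mul, transfer_mul, ← Matrix.mulVec_mulVec,
        ← Matrix.mulVec_mulVec]
      rfl
    · rw [pauliVec_cons_of_ne hk]
      rfl

theorem hasDerivAt_mulVec {ι : Type*} [Fintype ι] (A : Matrix ι ι ℝ) {v : ℝ → ι → ℝ}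
    {v' : ι → ℝ} {t : ℝ} (hv : ∀ i, HasDerivAt (fun t => v t i) (v' i) t) (i : ι) :
    HasDerivAt (fun t => A.mulVec (v t) i) (A.mulVec v' i) t :=
  HasDerivAt.fun_sum fun j _ => (hv j).const_mul (A i j)

theorem hasDerivAt_mulVec_const {ι : Type*} [Fintype ι] {A : ℝ → Matrix ι ι ℝ}
    {A' : Matrix ι ι ℝ} {t : ℝ} (hA : ∀ i j, HasDerivAt (fun t => A t i j) (A' i j) t)
    (v : ι → ℝ) (i : ι) : HasDerivAt (fun t => (A t).mulVec v i) (A'.mulVec v i) t :=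
  HasDerivAt.fun_sum fun j _ => (hA i j).mul_const (v j)

variable (c L R Ω μ) in
/-- The vector with entries `⟨0|U†σU|0⟩`, where `U` is composed of the blocks in the list `l`, the
last one first, and the conjugation by the rotation in the block `kμ` is replaced by its derivative.
If `kμ` occurs in `l`, this is the derivative with respect to the parameter `μ`. -/
noncomputable def derivVec (l : List (Fin m)) : (Fin M → ℝ) → PauliString N → ℝ :=
  pauliVec c L R (fun θ => rotDeriv Ω (θ μ)) l

theorem derivVec_nil : derivVec c L R Ω μ [] = fun _ => initialVec := rfl

theorem derivVec_cons_of_ne (hk : k ≠ kμ) :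
    derivVec c L R Ω μ (k :: l) = actUnitary (c.block k) (derivVec c L R Ω μ l) :=
  pauliVec_cons_of_ne hk

theorem derivVec_cons_self : derivVec c L R Ω μ (kμ :: l) =
    actUnitary R (actRotDeriv Ω (fun θ => θ μ) (actUnitary L (derivVec c L R Ω μ l))) :=
  pauliVec_cons_self

namespace IsDesignCircuit

theorem pauliVec_update (hc : IsDesignCircuit c π μ kμ Ω L R) (hl : kμ ∉ l)
    (K K' : (Fin M → ℝ) → Matrix (PauliString N) (PauliString N) ℝ) (θ : Fin M → ℝ) (t : ℝ) :
    pauliVec c L R K l (Function.update θ μ t) = pauliVec c L R K' l θ := by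
  induction l with
  | nil => rfl
  | cons k l ih =>
    have hk : k ≠ kμ := fun h => hl (h ▸ List.mem_cons_self)
    rw [pauliVec_cons_of_ne hk, pauliVec_cons_of_ne hk, actUnitary, actUnitary,
      hc.block_param k hk, ih fun h => hl (List.mem_cons_of_mem _ h)]

theorem hasDerivAt_pauliVec (hc : IsDesignCircuit c π μ kμ Ω L R) (hl : l.Nodup) (hkμ : kμ ∈ l)
    (θ : Fin M → ℝ) (σ : PauliString N) :
    HasDerivAt (fun t => pauliVec c L R (fun θ => transfer (rotation Ω (θ μ))) l
      (Function.update θ μ t) σ) (derivVec c L R Ω μ l θ σ) (θ μ) := by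
  induction l generalizing σ with
  | nil => simp at hkμ
  | cons k l ih =>
    obtain ⟨hkl, hl⟩ := List.nodup_cons.1 hl
    by_cases hk : k = kμ
    · subst hk
      simp only [pauliVec_cons_self, derivVec, actUnitary, hc.left_param θ, hc.right_param θ,
        Function.update_self,
        hc.pauliVec_update hkl _ (fun θ => rotDeriv Ω (θ μ)) θ]
      exact hasDerivAt_mulVec _
        (hasDerivAt_mulVec_const (hasDerivAt_transfer_rotation Ω (θ μ)) _) σ
    · simp only [pauliVec_cons_of_ne hk, derivVec_cons_of_ne hk, actUnitary,
        hc.block_param k hk θ]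
      exact hasDerivAt_mulVec _
        (ih hl (List.mem_of_ne_of_mem (Ne.symm hk) hkμ)) σ

theorem costDeriv_eq (hc : IsDesignCircuit c π μ kμ Ω L R) {J : Type} [Fintype J]
    (lam : J → ℝ) (h : J → PauliString N) (θ : Fin M → ℝ) :
    c.costDeriv (∑ j, (lam j : ℂ) • (h j).toOp) μ θ =
      ∑ j, lam j * derivVec c L R Ω μ (List.finRange m).reverse θ (h j) := by
  rw [Circuit.costDeriv]
  simp only [Circuit.cost_eq_sum, Circuit.unitary, transfer_prod_mulVec_initialVec hc.block_eq]
  refine (HasDerivAt.fun_sum fun j _ => HasDerivAt.const_mul (lam j) ?_).deriv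
  exact hc.hasDerivAt_pauliVec (List.nodup_reverse.2 (List.nodup_finRange m)) (by simp) θ (h j)

end IsDesignCircuit

end CircuitLayers

/-! ### Moments of the derivative of the cost -/

section Moments

variable {N m M : ℕ} {c : Circuit N m M} {kμ k : Fin m}
  {L R : (Fin M → ℝ) → LocalUnitary (c.s kμ)} {π : Measure (Fin M → ℝ)} {Ω : PauliString N}
  {μ : Fin M} {l : List (Fin m)}

variable (c L R μ) in
/-- The σ-algebra generated by the random object (a block, one of the sub-blocks `L` and `R`, or the
angle `θ_μ`) on which a layer depends. -/
noncomputable abbrev layerSigma : Layer kμ → MeasurableSpace (Fin M → ℝ) :=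
  Sum.elim (fun k => MeasurableSpace.comap (c.block k) inferInstance)
    ![MeasurableSpace.comap L inferInstance, MeasurableSpace.comap R inferInstance,
      MeasurableSpace.comap (fun θ : Fin M → ℝ => θ μ) inferInstance]

theorem measurable_layerMat (i : Layer kμ) (σ τ : PauliString N) :
    Measurable[layerSigma c L R μ i] fun θ =>
      layerMat c L R (fun θ => rotDeriv Ω (θ μ)) i θ σ τ := by
  have hunitary {s : Finset (Fin N)} (u : (Fin M → ℝ) → LocalUnitary s) :
      Measurable[MeasurableSpace.comap u inferInstance]
        fun θ => transfer (embed s (u θ).1) σ τ :=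
    (continuous_transfer_embed σ τ).measurable.comp (comap_measurable u)
  match i with
  | .inl k => exact hunitary (c.block k.1)
  | .inr 0 => exact hunitary L
  | .inr 1 => exact hunitary R
  | .inr 2 => exact (measurable_rotDeriv Ω σ τ).comp (comap_measurable fun θ : Fin M → ℝ => θ μ)

namespace IsDesignCircuit

theorem iIndep_layerSigma (hc : IsDesignCircuit c π μ kμ Ω L R) :
    iIndep (layerSigma c L R μ) π :=
  hc.indep

theorem layerSigma_le (hc : IsDesignCircuit c π μ kμ Ω L R) (i : Layer kμ) :
    layerSigma c L R μ i ≤ MeasurableSpace.pi :=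
  match i with
  | .inl k => (hc.block_measurable k.1 k.2).comap_le
  | .inr 0 => hc.left_measurable.comap_le
  | .inr 1 => hc.right_measurable.comap_le
  | .inr 2 => (measurable_pi_apply μ).comap_le

theorem isBoundedRandom_layerMat (hc : IsDesignCircuit c π μ kμ Ω L R) (i : Layer kμ) :
    IsBoundedRandom fun θ (p : PauliString N × PauliString N) =>
      layerMat c L R (fun θ => rotDeriv Ω (θ μ)) i θ p.1 p.2 where
  measurable := measurable_pi_lambda _ fun p =>
    (measurable_layerMat i p.1 p.2).mono (hc.layerSigma_le i) le_rfl
  bounded := by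
    have hunitary {s : Finset (Fin N)} (u : (Fin M → ℝ) → LocalUnitary s) :
        ∃ C : ℝ, ∀ θ (p : PauliString N × PauliString N),
          |transfer (embed s (u θ).1) p.1 p.2| ≤ C :=
      ⟨1, fun θ p => abs_transfer_le_one (embed_mem_unitaryGroup (u θ)) p.1 p.2⟩
    match i with
    | .inl k => exact hunitary (c.block k.1)
    | .inr 0 => exact hunitary L
    | .inr 1 => exact hunitary R
    | .inr 2 => exact ⟨2, fun θ p => abs_rotDeriv_le Ω (θ μ) p.1 p.2⟩

theorem isBoundedRandom_derivVec (hc : IsDesignCircuit c π μ kμ Ω L R) (l : List (Fin m)) :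
    IsBoundedRandom (derivVec c L R Ω μ l) :=
  .mulVecChain hc.isBoundedRandom_layerMat _ _

theorem indepApply (hc : IsDesignCircuit c π μ kμ Ω L R) {i : Layer kμ} {l : List (Layer kμ)}
    (hi : i ∉ l) :
    IndepApply π (layerMat c L R (fun θ => rotDeriv Ω (θ μ)) i)
      (mulVecChain (layerMat c L R fun θ => rotDeriv Ω (θ μ)) initialVec l) :=
  indepApply_mulVecChain hc.layerSigma_le hc.iIndep_layerSigma measurable_layerMat
    hc.isBoundedRandom_layerMat initialVec hi

theorem isDesignLayer (hc : IsDesignCircuit c π μ kμ Ω L R) (hk : k ≠ kμ) (hkl : k ∉ l) :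
    IsDesignLayer π (c.block k) (derivVec c L R Ω μ l) :=
  ⟨hc.block_measurable k hk, hc.block_design k hk,
    hc.indepApply (i := .inl ⟨k, hk⟩) fun hi => hkl (mem_of_mem_flatMap_blockLayers hi)⟩

theorem isDesignSandwich (hc : IsDesignCircuit c π μ kμ Ω L R) (hl : kμ ∉ l) :
    IsDesignSandwich π Ω (fun θ => θ μ) L R (derivVec c L R Ω μ l) := by
  have hnotMem (i : Fin 3) : (Sum.inr i : Layer kμ) ∉ l.flatMap (blockLayers kμ) :=
    fun hi => hl (mem_of_mem_flatMap_blockLayers hi)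
  exact ⟨hc.generator_nontrivial, hc.generator_supp,
    ⟨hc.left_measurable, hc.left_design, hc.indepApply (i := .inr 0) (hnotMem 0)⟩,
    hc.indepApply (i := .inr 2) (l := .inr 0 :: l.flatMap (blockLayers kμ)) (by simp [hnotMem]),
    ⟨hc.right_measurable, hc.right_design, hc.indepApply (i := .inr 1)
      (l := .inr 2 :: .inr 0 :: l.flatMap (blockLayers kμ)) (by simp [hnotMem])⟩⟩

variable [IsProbabilityMeasure π]

theorem uncorrelatedOn (hc : IsDesignCircuit c π μ kμ Ω L R) (hl : l.Nodup) :
    UncorrelatedOn π (derivVec c L R Ω μ l) (l.toFinset.biUnion c.s) := by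
  induction l with
  | nil => simp [UncorrelatedOn]
  | cons k l ih =>
    obtain ⟨hkl, hl⟩ := List.nodup_cons.1 hl
    rw [List.toFinset_cons, Finset.biUnion_insert, Finset.union_comm]
    by_cases hk : k = kμ
    · subst hk
      rw [derivVec_cons_self]
      exact (hc.isDesignSandwich hkl).uncorrelatedOn (ih hl)
    · rw [derivVec_cons_of_ne hk]
      exact (hc.isDesignLayer hk hkl).uncorrelatedOn (ih hl)

theorem integral_derivVec (hc : IsDesignCircuit c π μ kμ Ω L R) (hl : l.Nodup) (hkμ : kμ ∈ l)
    (σ : PauliString N) : ∫ θ, derivVec c L R Ω μ l θ σ ∂π = 0 := by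
  induction l generalizing σ with
  | nil => simp at hkμ
  | cons k l ih =>
    obtain ⟨hkl, hl⟩ := List.nodup_cons.1 hl
    by_cases hk : k = kμ
    · subst hk
      rw [derivVec_cons_self]
      exact (hc.isDesignSandwich hkl).integral_eq_zero σ
    · rw [derivVec_cons_of_ne hk]
      exact (hc.isDesignLayer hk hkl).integral_eq_zero
        (ih hl (List.mem_of_ne_of_mem (Ne.symm hk) hkμ)) σ

theorem le_integral_derivVec_sq_cons (hc : IsDesignCircuit c π μ kμ Ω L R) (hl : (k :: l).Nodup)
    {σ : PauliString N} (hσ : ∃ q ∈ c.s k, σ q ≠ .I) :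
    (if k = kμ then 2 else 1) * (((4 : ℝ) ^ (c.s k).card - 1)⁻¹ *
        ∑ τ ∈ nontrivialClass (c.s k) σ, ∫ θ, derivVec c L R Ω μ l θ τ ^ 2 ∂π) ≤
      ∫ θ, derivVec c L R Ω μ (k :: l) θ σ ^ 2 ∂π := by
  obtain ⟨hkl, hl⟩ := List.nodup_cons.1 hl
  split_ifs with hk
  · subst hk
    rw [derivVec_cons_self]
    exact (hc.isDesignSandwich hkl).le_integral_sq (hc.uncorrelatedOn hl) hσ
  · rw [derivVec_cons_of_ne hk, one_mul,
      (hc.isDesignLayer hk hkl).integral_sq_of_nontrivial hσ]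

theorem variance_costDeriv (hc : IsDesignCircuit c π μ kμ Ω L R) {J : Type} [Fintype J]
    (lam : J → ℝ) {h : J → PauliString N} (h_distinct : Function.Injective h)
    (h_supp : ∀ j, (h j).supp ⊆ c.supp) :
    Var[c.costDeriv (∑ j, (lam j : ℂ) • (h j).toOp) μ; π] =
      ∑ j, lam j ^ 2 * ∫ θ, derivVec c L R Ω μ (List.finRange m).reverse θ (h j) ^ 2 ∂π := by
  have hnodup : (List.finRange m).reverse.Nodup := List.nodup_reverse.2 (List.nodup_finRange m)
  have hmem_supp {j : J} {q : Fin N} (hq : h j q ≠ .I) : q ∈ c.supp :=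
    h_supp j (PauliString.mem_supp.2 hq)
  rw [funext (hc.costDeriv_eq lam h)]
  refine variance_sum_of_orthogonal
    (fun j => (hc.isBoundedRandom_derivVec _).memLp (h j) 2)
    (fun j => hc.integral_derivVec hnodup (by simp) (h j)) (fun j j' hne => ?_) lam
  obtain ⟨q, hq⟩ := Function.ne_iff.1 (h_distinct.ne hne)
  refine hc.uncorrelatedOn hnodup (h j) (h j') q ?_ hq
  rw [List.toFinset_reverse, List.toFinset_finRange]
  by_cases hI : h j q = .I
  · exact hmem_supp fun hI' => hq (hI.trans hI'.symm)
  · exact hmem_supp hI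

end IsDesignCircuit

end Moments

/-! ### Existence of path sets -/

section Paths

variable {N m : ℕ} {s : Fin m → Finset (Fin N)} {S : Finset (Fin N)} {k k' : Fin m} {q : Fin N}

theorem mem_connSupp :
    q ∈ connSupp s k k' ↔ q ∈ s k ∧ q ∈ s k' ∧ ∀ i, k < i → i < k' → q ∉ s i := by
  simp [connSupp, and_assoc]

theorem mem_fwdSupp : q ∈ fwdSupp s k ↔ q ∈ s k ∧ ∀ i < k, q ∉ s i := by
  simp [fwdSupp]

theorem mem_bwdSupp : q ∈ bwdSupp s k ↔ q ∈ s k ∧ ∀ i, k < i → q ∉ s i := by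
  simp [bwdSupp]

variable (s) in
/-- The relation between adjacent blocks of a path: the earlier block `k` hands a qubit directly
over to the block `k'`. -/
def Connected (k k' : Fin m) : Prop := k < k' ∧ (connSupp s k k').Nonempty

theorem le_of_reflTransGen (h : Relation.ReflTransGen (Connected s) k k') : k ≤ k' := by
  induction h with
  | refl => exact le_rfl
  | tail _ hconn ih => exact ih.trans hconn.1.le

theorem reflTransGen_of_mem_mem (hle : k ≤ k') (hk : q ∈ s k) (hk' : q ∈ s k') :
    Relation.ReflTransGen (Connected s) k k' := by
  induction hn : (k' : ℕ) - k using Nat.strong_induction_on generalizing k k' with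
  | _ n ih =>
    rcases hle.eq_or_lt with rfl | hlt
    · exact .refl
    by_cases h : ∃ i, k < i ∧ i < k' ∧ q ∈ s i
    · obtain ⟨i, hki, hik', hi⟩ := h
      exact (ih _ (by lia) hki.le hk hi rfl).trans (ih _ (by lia) hik'.le hi hk' rfl)
    · push Not at h
      exact .single ⟨hlt, q, mem_connSupp.2 ⟨hk, hk', h⟩⟩

theorem exists_bwdSupp (hk : q ∈ s k) :
    ∃ k', Relation.ReflTransGen (Connected s) k k' ∧ q ∈ bwdSupp s k' := by
  obtain ⟨k', hkk', hmax⟩ := Set.Finite.exists_le_maximal {i | q ∈ s i}.toFinite hk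
  exact ⟨k', reflTransGen_of_mem_mem hkk' hk hmax.1,
    mem_bwdSupp.2 ⟨hmax.1, fun i hi hq => hmax.not_gt hq hi⟩⟩

theorem exists_fwdSupp (hk : q ∈ s k) :
    ∃ k', Relation.ReflTransGen (Connected s) k' k ∧ q ∈ fwdSupp s k' := by
  obtain ⟨k', hkk', hmin⟩ := Set.Finite.exists_le_minimal {i | q ∈ s i}.toFinite hk
  exact ⟨k', reflTransGen_of_mem_mem hkk' hmin.1 hk,
    mem_fwdSupp.2 ⟨hmin.1, fun i hi hq => hmin.not_lt hq hi⟩⟩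

theorem exists_connSupp_next (hk : q ∈ s k) (hb : q ∉ bwdSupp s k) :
    ∃ k', k < k' ∧ q ∈ connSupp s k k' := by
  have hne : {i | k < i ∧ q ∈ s i}.Nonempty := by
    by_contra hempty
    exact hb (mem_bwdSupp.2 ⟨hk, fun i hi hq => hempty ⟨i, hi, hq⟩⟩)
  obtain ⟨k', ⟨hlt, hk'⟩, hmin⟩ := Set.Finite.exists_minimal (Set.toFinite _) hne
  refine ⟨k', hlt, mem_connSupp.2 ⟨hk, hk', fun i hki hik' hi => ?_⟩⟩
  exact (hmin ⟨hki, hi⟩ hik'.le).not_gt hik'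

theorem InCausalCone.exists_bwdSupp_inter (h : InCausalCone s S k) :
    ∃ k', Relation.ReflTransGen (Connected s) k k' ∧ (bwdSupp s k' ∩ S).Nonempty := by
  induction h with
  | base k h =>
    obtain ⟨q, hq⟩ := h
    rw [Finset.mem_inter] at hq
    obtain ⟨k', hkk', hk'⟩ := exists_bwdSupp hq.1
    exact ⟨k', hkk', q, Finset.mem_inter.2 ⟨hk', hq.2⟩⟩
  | step k k' hlt hov _ ih =>
    obtain ⟨q, hq⟩ := hov
    rw [Finset.mem_inter] at hq
    obtain ⟨l, hk'l, hl⟩ := ih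
    exact ⟨l, (reflTransGen_of_mem_mem hlt.le hq.1 hq.2).trans hk'l, hl⟩

theorem exists_isChain_cons_through {α : Type*} {r : α → α → Prop} {a b c : α}
    (hab : Relation.ReflTransGen r a b) (hbc : Relation.ReflTransGen r b c) :
    ∃ l : List α, (a :: l).IsChain r ∧ b ∈ a :: l ∧ (a :: l).getLast (by simp) = c := by
  induction hab using Relation.ReflTransGen.head_induction_on with
  | refl =>
    obtain ⟨l, hl, hlast⟩ := List.exists_isChain_cons_of_relationReflTransGen hbc
    exact ⟨l, hl, List.mem_cons_self, hlast⟩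
  | head h _ ih =>
    obtain ⟨l, hl, hb, hlast⟩ := ih
    exact ⟨_ :: l, List.isChain_cons_cons.2 ⟨h, hl⟩, List.mem_cons_of_mem _ hb,
      by simpa using hlast⟩

theorem exists_circuitPath_through (hk : (s k).Nonempty)
    (h : Relation.ReflTransGen (Connected s) k k') (hk' : (bwdSupp s k').Nonempty) :
    ∃ p : CircuitPath s, k ∈ p.nodes ∧ k' ∈ p.nodes := by
  obtain ⟨q, hq⟩ := hk
  obtain ⟨k₀, hk₀, hfwd⟩ := exists_fwdSupp hq
  obtain ⟨l, hl, hkl, rfl⟩ := exists_isChain_cons_through hk₀ h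
  exact ⟨⟨k₀ :: l, List.cons_ne_nil _ _, hl, ⟨q, hfwd⟩, hk'⟩, hkl, List.getLast_mem _⟩

theorem exists_circuitPath_mem_bwd (hq : q ∈ Finset.univ.biUnion s) :
    ∃ p : CircuitPath s, q ∈ p.bwd := by
  obtain ⟨k, -, hk⟩ := Finset.mem_biUnion.1 hq
  obtain ⟨k', hkk', hk'⟩ := exists_bwdSupp hk
  obtain ⟨p, -, hp⟩ := exists_circuitPath_through ⟨q, hk⟩ hkk' ⟨q, hk'⟩
  exact ⟨p, Finset.mem_biUnion.2 ⟨k', List.mem_toFinset.2 hp, hk'⟩⟩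

theorem exists_goesThroughAndCovers (hS : S ⊆ Finset.univ.biUnion s) (hk : (s k).Nonempty)
    (hcone : InCausalCone s S k) : ∃ P : PathSet s, P.GoesThroughAndCovers k S := by
  classical
  obtain ⟨k', hkk', hk'⟩ := hcone.exists_bwdSupp_inter
  obtain ⟨p, hkp, hk'p⟩ := exists_circuitPath_through hk hkk' (hk'.mono Finset.inter_subset_left)
  choose r hr using fun q : S => exists_circuitPath_mem_bwd (hS q.2)
  refine ⟨insert p (S.attach.image r), ⟨p, Finset.mem_insert_self _ _, hkp, k', hk'p,
    le_of_reflTransGen hkk', hk'⟩, fun q hq => Finset.mem_biUnion.2 ⟨r ⟨q, hq⟩, ?_, hr ⟨q, hq⟩⟩⟩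
  exact Finset.mem_insert_of_mem (Finset.mem_image_of_mem r (Finset.mem_attach _ _))

end Paths

/-! ### Edges of a path set -/

section Edges

theorem isChain_iff_forall_mem_zip_tail {α : Type*} {r : α → α → Prop} {l : List α} :
    l.IsChain r ↔ ∀ a b, (a, b) ∈ l.zip l.tail → r a b := by
  induction l with
  | nil => simp
  | cons a l ih =>
    cases l with
    | nil => simp
    | cons b l =>
      simp only [List.isChain_cons_cons, ih, List.tail_cons, List.zip_cons_cons, List.mem_cons,
        Prod.mk.injEq, or_imp, forall_and, and_imp, forall_eq_apply_imp_iff, forall_eq]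

theorem eq_head_or_mem_zip_tail {α : Type*} {l : List α} (hl : l ≠ []) {b : α} (hb : b ∈ l) :
    b = l.head hl ∨ ∃ a, (a, b) ∈ l.zip l.tail := by
  obtain ⟨i, hi, rfl⟩ := List.mem_iff_getElem.1 hb
  rcases i with _ | i
  · exact .inl (List.head_eq_getElem hl).symm
  · exact .inr ⟨l[i],
      List.mem_iff_getElem.2 ⟨i, by simpa [Nat.lt_sub_iff_add_lt] using hi, by simp⟩⟩

theorem reflTransGen_of_isChain {α : Type*} [PartialOrder α] {r : α → α → Prop} {l : List α}
    (hlt : l.IsChain (· < ·)) (hr : l.IsChain r) {a b : α} (ha : a ∈ l) (hb : b ∈ l)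
    (hab : a ≤ b) : Relation.ReflTransGen r a b := by
  have hpair : l.Pairwise (fun a b => a < b ∧ Relation.ReflTransGen r a b) :=
    (List.isChain_iff_pairwise.1 hlt).and
      (List.isChain_iff_pairwise.1 (hr.imp fun _ _ => Relation.ReflTransGen.single))
  refine List.Pairwise.forall_of_forall_of_flip
    (R := fun a b => a ≤ b → Relation.ReflTransGen r a b) (fun _ _ _ => .refl)
    (hpair.imp fun h _ => h.2) (hpair.imp fun h hle => absurd hle h.1.not_ge) ha hb hab

variable {N m : ℕ} {s : Fin m → Finset (Fin N)} {P : PathSet s} {p : CircuitPath s}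
  {e e' : Option (Fin m) × Fin m} {i k : Fin m} {o o' : Option (Fin m)}

variable (s) in
/-- The qubits handed over along an edge. -/
def edgeSupp : Option (Fin m) × Fin m → Finset (Fin N)
  | (none, k) => fwdSupp s k
  | (some i, k) => connSupp s i k

theorem edgeSupp_subset (e : Option (Fin m) × Fin m) : edgeSupp s e ⊆ s e.2 := by
  obtain ⟨_ | i, k⟩ := e
  · exact fun q hq => (mem_fwdSupp.1 hq).1
  · exact fun q hq => (mem_connSupp.1 hq).2.1

/-- An edge whose origin, if it is a block, precedes its target. -/
def IsForward (e : Option (Fin m) × Fin m) : Prop := ∀ i ∈ e.1, i < e.2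

theorem disjoint_edgeSupp (he : IsForward e) (he' : IsForward e') (hk : e.2 = e'.2) (hne : e ≠ e') :
    Disjoint (edgeSupp s e) (edgeSupp s e') := by
  rw [Finset.disjoint_left]
  intro q hq hq'
  obtain ⟨o, k⟩ := e
  obtain ⟨o', k'⟩ := e'
  obtain rfl : k = k' := hk
  match o, o' with
  | none, none => exact hne rfl
  | none, some i => exact (mem_fwdSupp.1 hq).2 i (he' i rfl) (mem_connSupp.1 hq').1
  | some i, none => exact (mem_fwdSupp.1 hq').2 i (he i rfl) (mem_connSupp.1 hq).1
  | some i, some j =>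
    obtain ⟨hi, -, hi'⟩ := mem_connSupp.1 hq
    obtain ⟨hj, -, hj'⟩ := mem_connSupp.1 hq'
    rcases lt_trichotomy i j with hij | rfl | hji
    · exact hi' j hij (he' j rfl) hj
    · exact hne rfl
    · exact hj' i hji (he i rfl) hi

theorem CircuitPath.mem_edges_none : (none, k) ∈ p.edges ↔ k = p.head := by
  simp [CircuitPath.edges]

theorem CircuitPath.mem_edges_some : (some i, k) ∈ p.edges ↔ (i, k) ∈ p.nodes.zip p.nodes.tail := by
  simp [CircuitPath.edges]

theorem CircuitPath.connected_of_mem_edges (h : (some i, k) ∈ p.edges) : Connected s i k :=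
  isChain_iff_forall_mem_zip_tail.1 p.chain i k (mem_edges_some.1 h)

theorem CircuitPath.exists_edge (hk : k ∈ p.nodes) : ∃ o, (o, k) ∈ p.edges := by
  rcases eq_head_or_mem_zip_tail p.ne_nil hk with hhead | ⟨i, hi⟩
  · exact ⟨none, mem_edges_none.2 hhead⟩
  · exact ⟨some i, mem_edges_some.2 hi⟩

namespace PathSet

/-- The edges of a path set. -/
def edges (P : PathSet s) : Finset (Option (Fin m) × Fin m) :=
  P.biUnion CircuitPath.edges

theorem mem_edges : e ∈ P.edges ↔ ∃ p ∈ P, e ∈ p.edges := Finset.mem_biUnion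

theorem isForward_of_mem_edges (he : e ∈ P.edges) : IsForward e := by
  obtain ⟨p, -, he⟩ := mem_edges.1 he
  obtain ⟨o, k⟩ := e
  rintro i (rfl : o = some i)
  exact (p.connected_of_mem_edges he).1

theorem edgeSupp_nonempty (he : e ∈ P.edges) : (edgeSupp s e).Nonempty := by
  obtain ⟨p, -, he⟩ := mem_edges.1 he
  obtain ⟨_ | i, k⟩ := e
  · rw [CircuitPath.mem_edges_none] at he
    exact he ▸ p.head_fwd
  · exact (p.connected_of_mem_edges he).2

theorem exists_edge (hp : p ∈ P) (hk : k ∈ p.nodes) : ∃ o, (o, k) ∈ P.edges :=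
  p.exists_edge hk |>.imp fun _ he => mem_edges.2 ⟨p, hp, he⟩

end PathSet

/-! ### The flow carried by a path set -/

variable (s) in
/-- A set of forward edges in which precisely those blocks are reached which are left again along
an edge of the set or along a qubit of `S` that no later block touches. -/
structure IsFlow (S : Finset (Fin N)) (E : Finset (Option (Fin m) × Fin m)) : Prop where
  forward : ∀ e ∈ E, IsForward e
  conserved : ∀ k, (∃ o, (o, k) ∈ E) ↔ (∃ k', (some k, k') ∈ E) ∨ (bwdSupp s k ∩ S).Nonempty

variable {S : Finset (Fin N)}

/-- The edges of a path set from which its edges lead to a qubit of `S`. A path of the set may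
extend beyond the last block it shares with an observable supported on `S`; the edges of such a
tail are not active. -/
inductive PathSet.IsActive (P : PathSet s) (S : Finset (Fin N)) : Option (Fin m) × Fin m → Prop
  | last (o : Option (Fin m)) (k : Fin m) :
      (o, k) ∈ P.edges → (bwdSupp s k ∩ S).Nonempty → IsActive P S (o, k)
  | step (o : Option (Fin m)) (k k' : Fin m) :
      (o, k) ∈ P.edges → IsActive P S (some k, k') → IsActive P S (o, k)

theorem PathSet.IsActive.mem_edges (h : P.IsActive S e) : e ∈ P.edges := by
  cases h <;> assumption

theorem PathSet.IsActive.of_mem_edges (h : P.IsActive S (o, k)) (ho' : (o', k) ∈ P.edges) :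
    P.IsActive S (o', k) := by
  cases h with
  | last _ _ _ hS => exact .last _ _ ho' hS
  | step _ _ k' _ hk' => exact .step _ _ k' ho' hk'

open Classical in
/-- The set of active edges of a path set. -/
noncomputable def PathSet.activeEdges (P : PathSet s) (S : Finset (Fin N)) :
    Finset (Option (Fin m) × Fin m) :=
  P.edges.filter (P.IsActive S)

theorem PathSet.mem_activeEdges : e ∈ P.activeEdges S ↔ P.IsActive S e := by
  classical rw [activeEdges, Finset.mem_filter, and_iff_right_of_imp IsActive.mem_edges]

theorem PathSet.activeEdges_subset : P.activeEdges S ⊆ P.edges :=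
  fun _ he => (mem_activeEdges.1 he).mem_edges

theorem eq_of_mem_bwdSupp {k' : Fin m} {q : Fin N} (hk : q ∈ bwdSupp s k)
    (hk' : q ∈ bwdSupp s k') : k = k' := by
  rw [mem_bwdSupp] at hk hk'
  exact le_antisymm (not_lt.1 fun h => hk'.2 k h hk.1) (not_lt.1 fun h => hk.2 k' h hk'.1)

namespace PathSet.GoesThroughAndCovers

variable {kμ : Fin m}

theorem isFlow (hP : P.GoesThroughAndCovers kμ S) : IsFlow s S (P.activeEdges S) where
  forward _ he := isForward_of_mem_edges (activeEdges_subset he)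
  conserved k := by
    simp only [mem_activeEdges]
    constructor
    · rintro ⟨o, _ | ⟨_, _, k', _, hk'⟩⟩
      · exact .inr ‹_›
      · exact .inl ⟨k', hk'⟩
    · rintro (⟨k', hk'⟩ | hS)
      · obtain ⟨p, hp, he⟩ := PathSet.mem_edges.1 hk'.mem_edges
        have hkp : k ∈ p.nodes := (List.of_mem_zip (CircuitPath.mem_edges_some.1 he)).1
        exact (exists_edge hp hkp).imp fun o ho => .step o k k' ho hk'
      · obtain ⟨q, hq⟩ := hS
        obtain ⟨hqk, hqS⟩ := Finset.mem_inter.1 hq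
        obtain ⟨p, hp, hqp⟩ := Finset.mem_biUnion.1 (hP.2 hqS)
        obtain ⟨k', hk'p, hqk'⟩ := Finset.mem_biUnion.1 hqp
        obtain rfl := eq_of_mem_bwdSupp hqk hqk'
        exact (exists_edge hp (List.mem_toFinset.1 hk'p)).imp fun o ho => .last o k ho ⟨q, hq⟩

theorem exists_mem_activeEdges (hP : P.GoesThroughAndCovers kμ S) :
    ∃ o, (o, kμ) ∈ P.activeEdges S := by
  obtain ⟨⟨p, hp, hkμ, k', hk', hle, hS⟩, -⟩ := hP
  simp only [mem_activeEdges]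
  have hreach : Relation.ReflTransGen (fun i k => (some i, k) ∈ P.edges) kμ k' :=
    reflTransGen_of_isChain (p.chain.imp fun _ _ h => h.1)
      (isChain_iff_forall_mem_zip_tail.2 fun i k hik =>
        PathSet.mem_edges.2 ⟨p, hp, CircuitPath.mem_edges_some.2 hik⟩) hkμ hk' hle
  suffices ∀ k, Relation.ReflTransGen (fun i k => (some i, k) ∈ P.edges) k k' →
      ∃ o, P.IsActive S (o, k) from this kμ hreach
  intro k hk
  induction hk using Relation.ReflTransGen.head_induction_on with
  | refl => exact (exists_edge hp hk').imp fun o ho => .last o k' ho hS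
  | @head i k hik _ ih =>
    obtain ⟨o, ho⟩ := ih
    obtain ⟨r, hr, he⟩ := PathSet.mem_edges.1 hik
    have hir : i ∈ r.nodes := (List.of_mem_zip (CircuitPath.mem_edges_some.1 he)).1
    exact (exists_edge hr hir).imp fun o' ho' => .step o' i k ho' (ho.of_mem_edges hik)

end PathSet.GoesThroughAndCovers

end Edges

/-! ### Pauli strings following a set of edges -/

section Continuations

variable {N m : ℕ} {s : Fin m → Finset (Fin N)} {E E' : Finset (Option (Fin m) × Fin m)}
  {e : Option (Fin m) × Fin m} {k : Fin m} {σ τ ρ : PauliString N}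

/-- The Pauli labels allowed on the qubits of an edge with the given origin: only `I` and `Z` have a
nonzero expectation in the initial state. -/
def edgeLabels : Option (Fin m) → Finset Pauli
  | none => {.I, .Z}
  | some _ => Finset.univ

theorem identity_mem_edgeLabels (o : Option (Fin m)) : .I ∈ edgeLabels o := by
  cases o <;> simp [edgeLabels]

variable (s) in
/-- The non-identity Pauli strings supported on the qubits of an edge, with allowed labels. -/
def edgeStrings (e : Option (Fin m) × Fin m) : Finset (PauliString N) :=
  (Fintype.piFinset fun q => if q ∈ edgeSupp s e then edgeLabels e.1 else {.I}).erase fun _ => .I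

theorem mem_edgeStrings : ρ ∈ edgeStrings s e ↔
    (∃ q ∈ edgeSupp s e, ρ q ≠ .I) ∧ (∀ q ∈ edgeSupp s e, ρ q ∈ edgeLabels e.1) ∧
      ∀ q, q ∉ edgeSupp s e → ρ q = .I := by
  have hpi : (ρ ∈ Fintype.piFinset fun q => if q ∈ edgeSupp s e then edgeLabels e.1 else {.I}) ↔
      (∀ q ∈ edgeSupp s e, ρ q ∈ edgeLabels e.1) ∧ ∀ q, q ∉ edgeSupp s e → ρ q = .I := by
    rw [Fintype.mem_piFinset, ← forall_and]
    refine forall_congr' fun q => ?_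
    by_cases hq : q ∈ edgeSupp s e <;> simp [hq]
  rw [edgeStrings, Finset.mem_erase, hpi, and_congr_left_iff]
  rintro ⟨-, hoff⟩
  rw [Function.ne_iff]
  exact exists_congr fun q =>
    (and_iff_right_of_imp fun hne => by_contra fun hq => hne (hoff q hq)).symm

theorem card_edgeStrings (e : Option (Fin m) × Fin m) :
    (edgeStrings s e).card = (edgeLabels e.1).card ^ (edgeSupp s e).card - 1 := by
  rw [edgeStrings, Finset.card_erase_of_mem]
  · simp [Fintype.card_piFinset, apply_ite Finset.card, Finset.prod_ite_mem]
  · rw [Fintype.mem_piFinset]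
    intro q
    split_ifs
    · exact identity_mem_edgeLabels e.1
    · exact Finset.mem_singleton_self _

theorem cast_card_edgeStrings_none (k : Fin m) :
    ((edgeStrings s (none, k)).card : ℝ) = 2 ^ (fwdSupp s k).card - 1 := by
  simp [card_edgeStrings, edgeLabels, edgeSupp, Nat.cast_sub Nat.one_le_two_pow]

theorem cast_card_edgeStrings_some (i k : Fin m) :
    ((edgeStrings s (some i, k)).card : ℝ) = 4 ^ (connSupp s i k).card - 1 := by
  simp [card_edgeStrings, edgeLabels, edgeSupp, Pauli.card_eq_four,
    Nat.cast_sub (Nat.one_le_pow _ 4 four_pos)]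

variable (s E) in
/-- On the qubits of the edge `e`, the string `σ` has allowed labels, and it is nontrivial there
precisely if `e` belongs to `E`. -/
structure FollowsOn (e : Option (Fin m) × Fin m) (σ : PauliString N) : Prop where
  mem_edgeLabels : ∀ q ∈ edgeSupp s e, σ q ∈ edgeLabels e.1
  mem_iff : e ∈ E ↔ ∃ q ∈ edgeSupp s e, σ q ≠ .I

theorem FollowsOn.congr (h : FollowsOn s E e σ) (hE : e ∈ E ↔ e ∈ E')
    (hσ : ∀ q ∈ edgeSupp s e, τ q = σ q) : FollowsOn s E' e τ where
  mem_edgeLabels q hq := hσ q hq ▸ h.mem_edgeLabels q hq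
  mem_iff := by
    rw [← hE, h.mem_iff]
    exact exists_congr fun q => and_congr_right fun hq => by rw [hσ q hq]

theorem FollowsOn.of_trivial (he : e ∉ E) (hσ : ∀ q ∈ edgeSupp s e, σ q = .I) :
    FollowsOn s E e σ where
  mem_edgeLabels q hq := hσ q hq ▸ identity_mem_edgeLabels e.1
  mem_iff := iff_of_false he fun ⟨q, hq, hne⟩ => hne (hσ q hq)

theorem FollowsOn.eq_of_notMem (h : FollowsOn s E e σ) (he : e ∉ E) {q : Fin N}
    (hq : q ∈ edgeSupp s e) : σ q = .I :=
  by_contra fun hne => he (h.mem_iff.2 ⟨q, hq, hne⟩)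

open Classical in
variable (s E) in
/-- The Pauli strings to which the block `k` can take `σ`, in the Heisenberg picture, so that they
follow `E` on all edges into `k`. -/
noncomputable def continuations (k : Fin m) (σ : PauliString N) : Finset (PauliString N) :=
  (agreeOff (s k) σ).filter fun τ => ∀ o, IsForward (o, k) → FollowsOn s E (o, k) τ

theorem mem_continuations : τ ∈ continuations s E k σ ↔
    (∀ q, q ∉ s k → τ q = σ q) ∧ ∀ o, IsForward (o, k) → FollowsOn s E (o, k) τ := by
  classical rw [continuations, Finset.mem_filter, mem_agreeOff]

theorem continuations_congr (h : ∀ o, (o, k) ∈ E ↔ (o, k) ∈ E') :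
    continuations s E k σ = continuations s E' k σ := by
  ext τ
  simp only [mem_continuations]
  exact and_congr_right fun _ => forall₂_congr fun o _ =>
    ⟨fun hf => hf.congr (h o) fun _ _ => rfl, fun hf => hf.congr (h o).symm fun _ _ => rfl⟩

theorem piecewise_mem_continuations (he : IsForward e) (hek : e.2 = k)
    (hρ : ρ ∈ edgeStrings s e) (hτ : τ ∈ continuations s E k σ) :
    (edgeSupp s e).piecewise ρ τ ∈ continuations s (insert e E) k σ := by
  obtain ⟨hne, hlab, -⟩ := mem_edgeStrings.1 hρ
  obtain ⟨hoff, hfol⟩ := mem_continuations.1 hτ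
  refine mem_continuations.2 ⟨fun q hq => ?_, fun o ho => ?_⟩
  · rw [Finset.piecewise_eq_of_notMem _ _ _ fun hqe => hq (hek ▸ edgeSupp_subset e hqe), hoff q hq]
  by_cases heq : (o, k) = e
  · have hfol' : FollowsOn s (insert e E) e ρ :=
      ⟨hlab, iff_of_true (Finset.mem_insert_self e E) hne⟩
    exact heq ▸ hfol'.congr Iff.rfl fun q hq => Finset.piecewise_eq_of_mem _ _ _ (heq ▸ hq)
  · refine (hfol o ho).congr (by simp [heq]) fun q hq => Finset.piecewise_eq_of_notMem _ _ _ ?_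
    exact Finset.disjoint_left.1 (disjoint_edgeSupp ho he hek.symm heq) hq

theorem card_edgeStrings_mul_card_continuations_le (he : IsForward e) (hek : e.2 = k) (heE : e ∉ E)
    (σ : PauliString N) : (edgeStrings s e).card * (continuations s E k σ).card ≤
      (continuations s (insert e E) k σ).card := by
  have htriv {τ : PauliString N} (hτ : τ ∈ continuations s E k σ) {q : Fin N}
      (hq : q ∈ edgeSupp s e) : τ q = .I := by
    subst hek
    exact ((mem_continuations.1 hτ).2 e.1 he).eq_of_notMem heE hq
  rw [← Finset.card_product]
  refine Finset.card_le_card_of_injOn (fun x => (edgeSupp s e).piecewise x.1 x.2) ?_ ?_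
  · intro x hx
    obtain ⟨hρ, hτ⟩ := Finset.mem_product.1 hx
    exact piecewise_mem_continuations he hek hρ hτ
  · rintro ⟨ρ, τ⟩ hx ⟨ρ', τ'⟩ hx' heq
    obtain ⟨hρ, hτ⟩ := Finset.mem_product.1 hx
    obtain ⟨hρ', hτ'⟩ := Finset.mem_product.1 hx'
    rw [Prod.mk.injEq, funext_iff, funext_iff, ← forall_and]
    intro q
    have hq := congrFun heq q
    by_cases hqe : q ∈ edgeSupp s e
    · simp only [Finset.piecewise_eq_of_mem _ _ _ hqe] at hq
      exact ⟨hq, (htriv hτ hqe).trans (htriv hτ' hqe).symm⟩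
    · simp only [Finset.piecewise_eq_of_notMem _ _ _ hqe] at hq
      exact ⟨((mem_edgeStrings.1 hρ).2.2 q hqe).trans ((mem_edgeStrings.1 hρ').2.2 q hqe).symm, hq⟩

theorem continuations_empty_nonempty (k : Fin m) (σ : PauliString N) :
    (continuations s ∅ k σ).Nonempty := by
  refine ⟨(s k).piecewise (fun _ => .I) σ, mem_continuations.2
    ⟨fun q hq => Finset.piecewise_eq_of_notMem _ _ _ hq, fun o _ => .of_trivial (by simp) ?_⟩⟩
  exact fun q hq => Finset.piecewise_eq_of_mem _ _ _ (edgeSupp_subset _ hq)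

theorem prod_card_edgeStrings_le_card_continuations (hE : ∀ e ∈ E, IsForward e) (k : Fin m)
    (σ : PauliString N) :
    ∏ e ∈ E with e.2 = k, (edgeStrings s e).card ≤ (continuations s E k σ).card := by
  have key (F : Finset (Option (Fin m) × Fin m)) (hF : ∀ e ∈ F, IsForward e ∧ e.2 = k) :
      ∏ e ∈ F, (edgeStrings s e).card ≤ (continuations s F k σ).card := by
    induction F using Finset.induction_on with
    | empty => simpa using (continuations_empty_nonempty k σ).card_pos
    | insert e F heF ih =>
      obtain ⟨⟨he, hek⟩, hF⟩ := Finset.forall_mem_insert .. |>.1 hF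
      rw [Finset.prod_insert heF]
      exact (Nat.mul_le_mul_left _ (ih hF)).trans
        (card_edgeStrings_mul_card_continuations_le he hek heF σ)
  rw [continuations_congr (E' := {e ∈ E | e.2 = k}) (by simp)]
  exact key _ fun e he => (Finset.mem_filter.1 he).imp_left (hE e)

end Continuations

/-! ### The bound for a flow -/

section Follows

variable {N m : ℕ} {s : Fin m → Finset (Fin N)} {E : Finset (Option (Fin m) × Fin m)}
  {h σ τ : PauliString N} {k : Fin m} {q : Fin N} {n : ℕ}

variable (s E h) in
/-- The Pauli string `σ`, obtained from `h` by undoing all blocks of index at least `n`, follows `E`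
on the edges which cross from the blocks before `n` to the later ones. -/
structure Follows (n : ℕ) (σ : PauliString N) : Prop where
  edge : ∀ e : Option (Fin m) × Fin m, (∀ i ∈ e.1, (i : ℕ) < n) → n ≤ e.2 → FollowsOn s E e σ
  bwd : ∀ k : Fin m, (k : ℕ) < n → ∀ q ∈ bwdSupp s k, σ q = h q
  off : ∀ q, (∀ k, q ∉ s k) → σ q = .I

namespace Follows

theorem initial (hh : h.supp ⊆ Finset.univ.biUnion s) : Follows s E h m h where
  edge e _ he := absurd e.2.isLt he.not_gt
  bwd _ _ _ _ := rfl
  off q hq := by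
    by_contra hne
    obtain ⟨k, -, hk⟩ := Finset.mem_biUnion.1 (hh (PauliString.mem_supp.2 hne))
    exact hq k hk

theorem initialVec_eq_one (hσ : Follows s E h 0 σ) : initialVec σ = 1 := by
  refine if_pos fun q => ?_
  by_cases hq : ∃ k, q ∈ s k
  · obtain ⟨k, hk⟩ := hq
    obtain ⟨k', -, hk'⟩ := exists_fwdSupp hk
    simpa [edgeLabels] using (hσ.edge (none, k') (by simp) (Nat.zero_le _)).mem_edgeLabels q hk'
  · exact .inl (hσ.off q (not_exists.1 hq))

theorem exists_ne_iff (hE : IsFlow s h.supp E) (hσ : Follows s E h (k + 1) σ) :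
    (∃ q ∈ s k, σ q ≠ .I) ↔ ∃ o, (o, k) ∈ E := by
  have hout {k' : Fin m} (hkk' : k < k') : FollowsOn s E (some k, k') σ :=
    hσ.edge _ (by simp) hkk'
  rw [hE.conserved]
  constructor
  · rintro ⟨q, hq, hne⟩
    by_cases hb : q ∈ bwdSupp s k
    · rw [hσ.bwd k k.val.lt_succ_self q hb] at hne
      exact .inr ⟨q, Finset.mem_inter.2 ⟨hb, PauliString.mem_supp.2 hne⟩⟩
    · obtain ⟨k', hkk', hk'⟩ := exists_connSupp_next hq hb
      exact .inl ⟨k', (hout hkk').mem_iff.2 ⟨q, hk', hne⟩⟩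
  · rintro (⟨k', hk'⟩ | ⟨q, hq⟩)
    · obtain ⟨q, hq, hne⟩ := (hout (hE.forward _ hk' k rfl)).mem_iff.1 hk'
      exact ⟨q, (mem_connSupp.1 hq).1, hne⟩
    · obtain ⟨hb, hS⟩ := Finset.mem_inter.1 hq
      refine ⟨q, (mem_bwdSupp.1 hb).1, ?_⟩
      rw [hσ.bwd k k.val.lt_succ_self q hb]
      exact PauliString.mem_supp.1 hS

theorem of_mem_continuations (hσ : Follows s E h (k + 1) σ) (hτ : τ ∈ continuations s E k σ) :
    Follows s E h k τ := by
  obtain ⟨hoff, hfol⟩ := mem_continuations.1 hτ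
  refine ⟨?_, fun i hi q hq => ?_, fun q hq => ?_⟩
  · rintro ⟨o, k'⟩ ho hk'
    rcases (Fin.le_def.2 hk').eq_or_lt with rfl | hlt
    · exact hfol o ho
    refine (hσ.edge (o, k') (fun i hi => (ho i hi).trans k.val.lt_succ_self) hlt).congr Iff.rfl
      fun q hq => hoff q ?_
    cases o with
    | none => exact (mem_fwdSupp.1 hq).2 k hlt
    | some i => exact (mem_connSupp.1 hq).2.2 k (ho i rfl) hlt
  · rw [hoff q ((mem_bwdSupp.1 hq).2 k hi)]
    exact hσ.bwd i (hi.trans k.val.lt_succ_self) q hq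
  · rw [hoff q (hq k)]
    exact hσ.off q hq

end Follows

theorem self_mem_continuations (hσ : ∀ q ∈ s k, σ q = .I) (hk : ¬∃ o, (o, k) ∈ E) :
    σ ∈ continuations s E k σ :=
  mem_continuations.2 ⟨fun _ _ => rfl, fun o _ =>
    .of_trivial (not_exists.1 hk o) fun q hq => hσ q (edgeSupp_subset _ hq)⟩

theorem continuations_subset_nontrivialClass (hE : ∀ e ∈ E, IsForward e) {o : Option (Fin m)}
    (hok : (o, k) ∈ E) (σ : PauliString N) :
    continuations s E k σ ⊆ nontrivialClass (s k) σ := by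
  intro τ hτ
  obtain ⟨hoff, hfol⟩ := mem_continuations.1 hτ
  obtain ⟨q, hq, hne⟩ := (hfol o (hE _ hok)).mem_iff.1 hok
  exact mem_nontrivialClass.2 ⟨hoff, q, edgeSupp_subset _ hq, hne⟩

end Follows

section Weights

variable {N m : ℕ} {s : Fin m → Finset (Fin N)} {E : Finset (Option (Fin m) × Fin m)}
  {k kμ : Fin m}

variable (s) in
/-- The fraction of the nontrivial Pauli strings on the target of an edge which are supported on the
qubits of the edge, with allowed labels. -/
noncomputable def edgeWeight (e : Option (Fin m) × Fin m) : ℝ :=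
  (edgeStrings s e).card / ((4 : ℝ) ^ (s e.2).card - 1)

theorem four_pow_sub_one_nonneg (n : ℕ) : (0 : ℝ) ≤ 4 ^ n - 1 :=
  sub_nonneg.2 (one_le_pow₀ (by norm_num))

theorem edgeWeight_nonneg (e : Option (Fin m) × Fin m) : 0 ≤ edgeWeight s e :=
  div_nonneg (Nat.cast_nonneg _) (four_pow_sub_one_nonneg _)

theorem edgeWeight_le_one (e : Option (Fin m) × Fin m) : edgeWeight s e ≤ 1 := by
  have hlab : (edgeLabels e.1).card ≤ 4 := Finset.card_le_univ _
  have hlab_pos : 0 < (edgeLabels e.1).card := Finset.card_pos.2 ⟨_, identity_mem_edgeLabels e.1⟩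
  have hcard : (edgeStrings s e).card + 1 ≤ 4 ^ (s e.2).card := by
    rw [card_edgeStrings, Nat.sub_add_cancel (Nat.one_le_pow _ _ hlab_pos)]
    exact (Nat.pow_le_pow_left hlab _).trans
      (Nat.pow_le_pow_right four_pos (Finset.card_le_card (edgeSupp_subset e)))
  refine div_le_one_of_le₀ (le_sub_iff_add_le.2 ?_) (four_pow_sub_one_nonneg _)
  exact_mod_cast hcard

variable (s E kμ) in
/-- The factor which the block `k` contributes to the bound for the flow `E`. -/
noncomputable def blockWeight (k : Fin m) : ℝ :=
  (if k = kμ then 2 else 1) * ∏ e ∈ E with e.2 = k, edgeWeight s e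

theorem blockWeight_nonneg (k : Fin m) : 0 ≤ blockWeight s E kμ k :=
  mul_nonneg (by split_ifs <;> norm_num) (Finset.prod_nonneg fun e _ => edgeWeight_nonneg e)

theorem prod_blockWeight (s : Fin m → Finset (Fin N)) (E : Finset (Option (Fin m) × Fin m))
    (kμ : Fin m) : ∏ k, blockWeight s E kμ k = 2 * ∏ e ∈ E, edgeWeight s e := by
  simp only [blockWeight, Finset.prod_mul_distrib, Finset.prod_fiberwise, Finset.prod_ite_eq',
    Finset.mem_univ, if_true]

theorem prod_edgeWeight_le {o : Option (Fin m)} (hok : (o, k) ∈ E) (hk : (s k).Nonempty) :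
    ∏ e ∈ E with e.2 = k, edgeWeight s e ≤
      ((4 : ℝ) ^ (s k).card - 1)⁻¹ * ∏ e ∈ E with e.2 = k, ((edgeStrings s e).card : ℝ) := by
  have hone : (1 : ℝ) ≤ 4 ^ (s k).card - 1 := by
    have := le_self_pow₀ (show (1 : ℝ) ≤ 4 by norm_num) hk.card_pos.ne'
    linarith
  have hcard : ({e ∈ E | e.2 = k}).card ≠ 0 :=
    Finset.card_ne_zero_of_mem (Finset.mem_filter.2 ⟨hok, rfl⟩)
  calc ∏ e ∈ E with e.2 = k, edgeWeight s e
      = ∏ e ∈ E with e.2 = k, ((4 : ℝ) ^ (s k).card - 1)⁻¹ * (edgeStrings s e).card :=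
        Finset.prod_congr rfl fun e he => by
          rw [edgeWeight, (Finset.mem_filter.1 he).2, div_eq_inv_mul]
    _ = ((4 : ℝ) ^ (s k).card - 1)⁻¹ ^ ({e ∈ E | e.2 = k}).card *
          ∏ e ∈ E with e.2 = k, ((edgeStrings s e).card : ℝ) := by
        rw [Finset.prod_mul_distrib, Finset.prod_const]
    _ ≤ _ := mul_le_mul_of_nonneg_right
        (pow_le_of_le_one (inv_nonneg.2 (four_pow_sub_one_nonneg _)) (inv_le_one_of_one_le₀ hone)
          hcard) (Finset.prod_nonneg fun e _ => Nat.cast_nonneg _)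

theorem blockWeight_le (hE : ∀ e ∈ E, IsForward e) {o : Option (Fin m)} (hok : (o, k) ∈ E)
    (hk : (s k).Nonempty) (σ : PauliString N) :
    blockWeight s E kμ k ≤ (if k = kμ then 2 else 1) *
      (((4 : ℝ) ^ (s k).card - 1)⁻¹ * (continuations s E k σ).card) := by
  refine mul_le_mul_of_nonneg_left ((prod_edgeWeight_le hok hk).trans ?_)
    (by split_ifs <;> norm_num)
  refine mul_le_mul_of_nonneg_left ?_ (inv_nonneg.2 (four_pow_sub_one_nonneg _))
  exact_mod_cast prod_card_edgeStrings_le_card_continuations hE k σ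

end Weights

section Bound

/-- The blocks of index less than `n`, the last one first. -/
def blocksBefore (m n : ℕ) : List (Fin m) := ((List.finRange m).take n).reverse

theorem blocksBefore_succ {m : ℕ} (k : Fin m) : blocksBefore m (k + 1) = k :: blocksBefore m k := by
  rw [blocksBefore, List.take_succ_eq_append_getElem (by simp), List.reverse_append]
  simp [blocksBefore]

theorem blocksBefore_self (m : ℕ) : blocksBefore m m = (List.finRange m).reverse := by
  rw [blocksBefore, List.take_of_length_le (by simp)]

theorem nodup_blocksBefore (m n : ℕ) : (blocksBefore m n).Nodup :=
  List.nodup_reverse.2 ((List.nodup_finRange m).take)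

variable {N m M : ℕ} {c : Circuit N m M} {π : Measure (Fin M → ℝ)} [IsProbabilityMeasure π]
  {μ : Fin M} {k kμ : Fin m} {Ω : PauliString N} {L R : (Fin M → ℝ) → LocalUnitary (c.s kμ)}
  {E : Finset (Option (Fin m) × Fin m)} {h σ : PauliString N}

namespace IsDesignCircuit

theorem blockWeight_mul_le (hc : IsDesignCircuit c π μ kμ Ω L R) (hE : ∀ e ∈ E, IsForward e)
    {o : Option (Fin m)} (hok : (o, k) ∈ E) {l : List (Fin m)} (hl : (k :: l).Nodup)
    (hσ : ∃ q ∈ c.s k, σ q ≠ .I) {w : ℝ} (hw : 0 ≤ w)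
    (hle : ∀ τ ∈ continuations c.s E k σ, w ≤ ∫ θ, derivVec c L R Ω μ l θ τ ^ 2 ∂π) :
    blockWeight c.s E kμ k * w ≤ ∫ θ, derivVec c L R Ω μ (k :: l) θ σ ^ 2 ∂π := by
  have hfactor : (0 : ℝ) ≤ if k = kμ then 2 else 1 := by split_ifs <;> norm_num
  have hinv : (0 : ℝ) ≤ ((4 : ℝ) ^ (c.s k).card - 1)⁻¹ := inv_nonneg.2 (four_pow_sub_one_nonneg _)
  calc blockWeight c.s E kμ k * w
      ≤ (if k = kμ then 2 else 1) *
          (((4 : ℝ) ^ (c.s k).card - 1)⁻¹ * (continuations c.s E k σ).card) * w :=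
        mul_le_mul_of_nonneg_right (blockWeight_le hE hok (hσ.imp fun q hq => hq.1) σ) hw
    _ = (if k = kμ then 2 else 1) * (((4 : ℝ) ^ (c.s k).card - 1)⁻¹ *
          ∑ _τ ∈ continuations c.s E k σ, w) := by
        rw [Finset.sum_const, nsmul_eq_mul, mul_assoc, mul_assoc]
    _ ≤ (if k = kμ then 2 else 1) * (((4 : ℝ) ^ (c.s k).card - 1)⁻¹ *
          ∑ τ ∈ nontrivialClass (c.s k) σ, ∫ θ, derivVec c L R Ω μ l θ τ ^ 2 ∂π) :=
        mul_le_mul_of_nonneg_left (mul_le_mul_of_nonneg_left ((Finset.sum_le_sum hle).trans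
          (Finset.sum_le_sum_of_subset_of_nonneg (continuations_subset_nontrivialClass hE hok σ)
            fun τ _ _ => integral_nonneg fun θ => sq_nonneg _)) hinv) hfactor
    _ ≤ _ := hc.le_integral_derivVec_sq_cons hl hσ

theorem prod_map_blockWeight_le (hc : IsDesignCircuit c π μ kμ Ω L R) (hE : IsFlow c.s h.supp E)
    (hkμ : ∃ o, (o, kμ) ∈ E) {n : ℕ} (hn : n ≤ m) (hσ : Follows c.s E h n σ) :
    ((blocksBefore m n).map (blockWeight c.s E kμ)).prod ≤
      ∫ θ, derivVec c L R Ω μ (blocksBefore m n) θ σ ^ 2 ∂π := by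
  induction n generalizing σ with
  | zero => simp [blocksBefore, derivVec_nil, hσ.initialVec_eq_one]
  | succ n ih =>
    obtain ⟨k, rfl⟩ : ∃ k : Fin m, (k : ℕ) = n := ⟨⟨n, hn⟩, rfl⟩
    have hreach := hσ.exists_ne_iff hE
    have hnodup := nodup_blocksBefore m (k + 1)
    have hih {τ : PauliString N} (hτ : τ ∈ continuations c.s E k σ) :=
      ih k.isLt.le (hσ.of_mem_continuations hτ)
    rw [blocksBefore_succ] at hnodup ⊢
    rw [List.map_cons, List.prod_cons]
    by_cases hk : ∃ o, (o, k) ∈ E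
    · obtain ⟨o, hok⟩ := hk
      refine hc.blockWeight_mul_le hE.forward hok hnodup (hreach.2 ⟨o, hok⟩) ?_ fun τ => hih
      refine List.prod_nonneg fun x hx => ?_
      obtain ⟨i, -, rfl⟩ := List.mem_map.1 hx
      exact blockWeight_nonneg i
    · have hne : k ≠ kμ := fun heq => hk (heq ▸ hkμ)
      have htriv : ∀ q ∈ c.s k, σ q = .I := by
        simpa using mt hreach.1 hk
      have hweight : blockWeight c.s E kμ k = 1 := by
        rw [blockWeight, if_neg hne, one_mul, Finset.prod_eq_one]
        exact fun e he => absurd ⟨e.1, (Finset.mem_filter.1 he).2 ▸ (Finset.mem_filter.1 he).1⟩ hk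
      simp only [hweight, one_mul, derivVec_cons_of_ne hne, actUnitary_of_trivial _ _ htriv]
      exact hih (self_mem_continuations htriv hk)

theorem two_mul_prod_edgeWeight_le (hc : IsDesignCircuit c π μ kμ Ω L R)
    (hE : IsFlow c.s h.supp E) (hkμ : ∃ o, (o, kμ) ∈ E) (hh : h.supp ⊆ c.supp) :
    2 * ∏ e ∈ E, edgeWeight c.s e ≤
      ∫ θ, derivVec c L R Ω μ (List.finRange m).reverse θ h ^ 2 ∂π := by
  have hbound := hc.prod_map_blockWeight_le hE hkμ le_rfl (.initial hh)
  rwa [blocksBefore_self, List.map_reverse, List.prod_reverse, ← Fin.prod_univ_def,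
    prod_blockWeight] at hbound

end IsDesignCircuit

end Bound

/-! ### Comparison with lengths and widths -/

section Lengths

variable {N m : ℕ} {s : Fin m → Finset (Fin N)} {e : Option (Fin m) × Fin m} {i k : Fin m}
  {P : PathSet s}

theorem two_rpow_neg_two_mul_logb {x : ℝ} (hx : 0 < x) :
    (2 : ℝ) ^ (-(2 * Real.logb 4 x)) = x⁻¹ := by
  rw [Real.rpow_neg zero_le_two, Real.rpow_mul zero_le_two,
    show (2 : ℝ) ^ (2 : ℝ) = 4 by norm_num, Real.rpow_logb four_pos (by norm_num) hx]

theorem pow_card_sub_one_pos {S : Finset (Fin N)} (hS : S.Nonempty) {b : ℝ} (hb : 1 < b) :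
    0 < b ^ S.card - 1 :=
  sub_pos.2 (one_lt_pow₀ hb hS.card_pos.ne')

theorem two_rpow_neg_edgeLength_some (h : (connSupp s i k).Nonempty) :
    (2 : ℝ) ^ (-(2 * edgeLength s (some i, k))) = edgeWeight s (some i, k) := by
  have hk : (s k).Nonempty := h.mono (edgeSupp_subset (some i, k))
  rw [edgeLength, two_rpow_neg_two_mul_logb, inv_div, edgeWeight, cast_card_edgeStrings_some]
  exact div_pos (pow_card_sub_one_pos hk (by norm_num)) (pow_card_sub_one_pos h (by norm_num))

theorem two_rpow_neg_edgeLength_none (h : (fwdSupp s k).Nonempty) :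
    (2 : ℝ) ^ (-(2 * edgeLength s (none, k))) * (2 : ℝ) ^ (-fwdWidth s k) =
      edgeWeight s (none, k) := by
  have hk : (s k).Nonempty := h.mono (edgeSupp_subset (none, k))
  have h4s := pow_card_sub_one_pos hk (b := 4) (by norm_num)
  have h4 := pow_card_sub_one_pos h (b := 4) (by norm_num)
  have h2 := pow_card_sub_one_pos h (b := 2) (by norm_num)
  rw [edgeLength, fwdWidth, two_rpow_neg_two_mul_logb (div_pos h4s h4), Real.rpow_neg zero_le_two,
    Real.rpow_logb two_pos (by norm_num) (div_pos h4 h2), edgeWeight, cast_card_edgeStrings_none,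
    inv_div, inv_div, mul_comm, div_mul_div_cancel₀ h4.ne']

namespace PathSet

theorem two_rpow_neg_edgeLength (he : e ∈ P.edges) :
    (2 : ℝ) ^ (-(2 * edgeLength s e)) * (if e.1 = none then (2 : ℝ) ^ (-fwdWidth s e.2) else 1) =
      edgeWeight s e := by
  have hne := edgeSupp_nonempty he
  obtain ⟨_ | i, k⟩ := e
  · exact two_rpow_neg_edgeLength_none hne
  · simpa using two_rpow_neg_edgeLength_some hne

theorem prod_image_head {M : Type*} [CommMonoid M] (P : PathSet s) (f : Fin m → M) :
    ∏ k ∈ P.image CircuitPath.head, f k = ∏ e ∈ P.edges, if e.1 = none then f e.2 else 1 := by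
  have himage : {e ∈ P.edges | e.1 = none} = (P.image CircuitPath.head).image (Prod.mk none) := by
    ext ⟨o, k⟩
    cases o <;> simp [mem_edges, CircuitPath.mem_edges_none, eq_comm]
  rw [← Finset.prod_filter, himage, eq_comm]
  exact Finset.prod_image (Prod.mk_right_injective none).injOn

theorem two_rpow_eq_prod (P : PathSet s) :
    (2 : ℝ) ^ (1 - 2 * P.length - P.headWidth) = 2 * ∏ e ∈ P.edges, edgeWeight s e := by
  have hsplit : 1 - 2 * P.length - P.headWidth =
      1 + (∑ e ∈ P.edges, -(2 * edgeLength s e) +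
        ∑ k ∈ P.image CircuitPath.head, -fwdWidth s k) := by
    rw [length, headWidth, edges, Finset.sum_neg_distrib, Finset.sum_neg_distrib, Finset.mul_sum]
    ring
  rw [hsplit, Real.rpow_add two_pos, Real.rpow_add two_pos, Real.rpow_one,
    Real.rpow_sum_of_pos two_pos, Real.rpow_sum_of_pos two_pos, prod_image_head,
    ← Finset.prod_mul_distrib, Finset.prod_congr rfl fun e he => two_rpow_neg_edgeLength he]

theorem two_rpow_le_prod_activeEdges (P : PathSet s) (S : Finset (Fin N)) :
    (2 : ℝ) ^ (1 - 2 * P.length - P.headWidth) ≤ 2 * ∏ e ∈ P.activeEdges S, edgeWeight s e := by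
  rw [two_rpow_eq_prod]
  exact mul_le_mul_of_nonneg_left (Finset.prod_le_prod_of_subset_of_le_one activeEdges_subset
    (fun e _ => edgeWeight_nonneg e) fun e _ _ => edgeWeight_le_one e) zero_le_two

end PathSet

end Lengths

theorem IsDesignCircuit.two_rpow_le_integral_derivVec_sq {N m M : ℕ} {c : Circuit N m M}
    {π : Measure (Fin M → ℝ)} [IsProbabilityMeasure π] {μ : Fin M} {kμ : Fin m} {Ω : PauliString N}
    {L R : (Fin M → ℝ) → LocalUnitary (c.s kμ)} (hc : IsDesignCircuit c π μ kμ Ω L R)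
    {h : PauliString N} (hh : h.supp ⊆ c.supp) {P : PathSet c.s}
    (hP : P.GoesThroughAndCovers kμ h.supp) :
    (2 : ℝ) ^ (1 - 2 * P.length - P.headWidth) ≤
      ∫ θ, derivVec c L R Ω μ (List.finRange m).reverse θ h ^ 2 ∂π :=
  (P.two_rpow_le_prod_activeEdges h.supp).trans
    (hc.two_mul_prod_edgeWeight_le hP.isFlow hP.exists_mem_activeEdges hh)

end PathBound

theorem theorem1 {N m M : ℕ} (c : PathBound.Circuit N m M)
    (π : MeasureTheory.Measure (Fin M → ℝ)) [MeasureTheory.IsProbabilityMeasure π]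
    (μ : Fin M) (kμ : Fin m) (Ω : PathBound.PauliString N)
    (L R : (Fin M → ℝ) → PathBound.LocalUnitary (c.s kμ))
    (hc : PathBound.IsDesignCircuit c π μ kμ Ω L R)
    {J : Type} [Fintype J] (lam : J → ℝ) (h : J → PathBound.PauliString N)
    (h_distinct : Function.Injective h)
    (H : PathBound.Op N) (hH : H = ∑ j, (lam j : ℂ) • (h j).toOp)
    (h_supp : ∀ j, (h j).supp ⊆ c.supp) :
    (∀ j, PathBound.InCausalCone c.s (h j).supp kμ →
      ∃ P : PathBound.PathSet c.s, P.GoesThroughAndCovers kμ (h j).supp) ∧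
    ∀ P : J → PathBound.PathSet c.s,
      (∀ j, PathBound.InCausalCone c.s (h j).supp kμ →
        (P j).GoesThroughAndCovers kμ (h j).supp) →
      ∑ j ∈ PathBound.coneTerms c.s h kμ,
          lam j ^ 2 * (2 : ℝ) ^ (1 - 2 * (P j).length - (P j).headWidth) ≤
        ProbabilityTheory.variance (c.costDeriv H μ) π := by
  refine ⟨fun j hj => PathBound.exists_goesThroughAndCovers (h_supp j)
    (hc.generator_nontrivial.mono hc.generator_supp) hj, fun P hP => ?_⟩
  rw [hH, hc.variance_costDeriv lam h_distinct h_supp]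
  calc ∑ j ∈ PathBound.coneTerms c.s h kμ,
        lam j ^ 2 * (2 : ℝ) ^ (1 - 2 * (P j).length - (P j).headWidth)
      ≤ ∑ j ∈ PathBound.coneTerms c.s h kμ, lam j ^ 2 *
          ∫ θ, PathBound.derivVec c L R Ω μ (List.finRange m).reverse θ (h j) ^ 2 ∂π := by
        refine Finset.sum_le_sum fun j hj => mul_le_mul_of_nonneg_left ?_ (sq_nonneg _)
        have hcone : PathBound.InCausalCone c.s (h j).supp kμ := by
          simpa [PathBound.coneTerms] using hj
        exact hc.two_rpow_le_integral_derivVec_sq (h_supp j) (hP j hcone)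
    _ ≤ _ := Finset.sum_le_sum_of_subset_of_nonneg (Finset.subset_univ _) fun j _ _ =>
        mul_nonneg (sq_nonneg _) (MeasureTheory.integral_nonneg fun θ => sq_nonneg _)
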